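/- All spaces are compactly generated and products are taken in the category of compactly generated spaces. Let $X$ be a path connected compactly generated space with a nondegenerate basepoint $*$ (that is, $(X,\{*\})$ is an NDR-pair), and suppose that $X$ has weak LS-category less than $2$, i.e. the reduced diagonal $\bar\Delta\colon X\to X\wedge X$, $x\mapsto x\wedge x$, is null homotopic. Let $J(X)$ be the James construction, i.e. the free monoid on $X$ modulo the relation that $*$ is the unit, with the quotient topology from $\bigsqcup_{k\ge 0}X^k$, and let $E\colon X\to J(X)$ be the canonical inclusion. For $n\ge 0$ let $[X^n,J(X)]$ be the set of pointed homotopy classes of pointed maps with the pointwise product; let $p_i\colon X^n\to X$ be the $i$-th coordinate projection, and let $K_n(X)$ be the subgroup of $[X^n,J(X)]$ generated by the classes $[E\circ p_i]$, $1\le i\le n$. Write $[a,b]=a^{-1}b^{-1}ab$ and $[[a_1,\dots,a_l]]=[\cdots[[a_1,a_2],a_3],\cdots,a_l]$ (so $[[a_1]]=a_1$). Let $K_n$ be Cohen's group, the quotient of the free group on $x_1,\dots,x_n$ by the relations 1. $[[x_{i_1},x_{i_2},\dots,x_{i_l}]]=1$ whenever $i_s=i_t$ for some $1\le s<t\le l$;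 2. $[[x_{i_1}^{n_1},x_{i_2}^{n_2},\dots,x_{i_l}^{n_l}]]=[[x_{i_1},x_{i_2},\dots,x_{i_l}]]^{n_1n_2\cdots n_l}$ for all $l\ge 1$, all indices $i_1,\dots,i_l$ and all integers $n_1,\dots,n_l$. Then $[X^n,J(X)]$ is a group, and there is a group homomorphism $$e_X\colon K_n\longrightarrow K_n(X)\subseteq[X^n,J(X)]$$ with $e_X(x_i)=[E\circ p_i]$ for $1\le i\le n$. -/

import Mathlib

open Topology
open scoped unitInterval

universe u

noncomputable section

/-! ### Compactly generated products -/

/-- The `n`-fold Cartesian power of `X` in the category of compactly generated spaces: the set of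
`n`-tuples, with the compactly generated refinement of the product topology. -/
abbrev KPow (X : Type u) [TopologicalSpace X] (n : ℕ) : Type u :=
  WithGeneratedByTopology (fun K : CompHaus.{u} => (K : Type u)) (Fin n → X)

/-- The point of `KPow X n` with coordinates `x`. -/
def KPow.mk {X : Type u} [TopologicalSpace X] {n : ℕ} (x : Fin n → X) : KPow X n :=
  WithGeneratedByTopology.equiv.symm x

/-- The `i`-th coordinate of a point of `KPow X n`. -/
def KPow.coord {X : Type u} [TopologicalSpace X] {n : ℕ} (x : KPow X n) (i : Fin n) : X :=
  WithGeneratedByTopology.equiv x i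

theorem KPow.continuous_coord {X : Type u} [TopologicalSpace X] {n : ℕ} (i : Fin n) :
    Continuous fun x : KPow X n => x.coord i :=
  (continuous_apply i).comp WithGeneratedByTopology.continuous_equiv

theorem KPow.continuous_comp_mk {X : Type u} [TopologicalSpace X] {K : Type u}
    [TopologicalSpace K] [CompactSpace K] [T2Space K] {n : ℕ} {f : K → Fin n → X}
    (hf : Continuous f) : Continuous fun k => KPow.mk (f k) := by
  rw [continuous_def]
  intro U hU
  rw [WithGeneratedByTopology.isOpen_iff] at hU
  exact hU (i := CompHaus.of K) ⟨f, hf⟩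

instance KPow.compactlyGeneratedSpace (X : Type u) [TopologicalSpace X] (n : ℕ) :
    CompactlyGeneratedSpace (KPow X n) := by
  refine compactlyGeneratedSpace_of_isOpen fun s hs => ?_
  rw [WithGeneratedByTopology.isOpen_iff]
  intro K f
  exact hs K (fun k => KPow.mk (f k)) (KPow.continuous_comp_mk f.continuous)

/-- A map into `KPow X n` from a compactly generated space is continuous when its coordinates
are. -/
theorem KPow.continuous_mk {X : Type u} [TopologicalSpace X] {Z : Type u} [TopologicalSpace Z]
    [CompactlyGeneratedSpace Z] {n : ℕ} {f : Z → Fin n → X} (hf : Continuous f) :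
    Continuous fun z => KPow.mk (f z) :=
  continuous_from_compactlyGeneratedSpace _ fun K _ _ _ g hg =>
    KPow.continuous_comp_mk (K := K) (f := fun k => f (g k)) (hf.comp hg)

/-! ### Nondegenerate basepoints, smash powers and weak LS-category -/

/-- The basepoint `x₀` is nondegenerate: `(X, {x₀})` is an NDR-pair. -/
def NondegenerateBasepoint {X : Type u} [TopologicalSpace X] (x₀ : X) : Prop :=
  ∃ (v : C(X, I)) (h : C(X × I, X)),
    (∀ x, v x = 0 ↔ x = x₀) ∧ (∀ x, h (x, 0) = x) ∧ (∀ t, h (x₀, t) = x₀) ∧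
      ∀ x, v x < 1 → h (x, 1) = x₀

/-- The relation on `X ^ k` collapsing the fat wedge (the tuples with at least one coordinate equal
to `x₀`) to one point. -/
def smashSetoid {X : Type u} [TopologicalSpace X] (x₀ : X) (k : ℕ) : Setoid (KPow X k) where
  r x y := x = y ∨ ((∃ i, x.coord i = x₀) ∧ ∃ j, y.coord j = x₀)
  iseqv :=
    { refl := fun _ => Or.inl rfl
      symm := by
        rintro x y (h | ⟨h, h'⟩)
        · exact Or.inl h.symm
        · exact Or.inr ⟨h', h⟩
      trans := by
        rintro x y z (rfl | ⟨h, h'⟩) (rfl | ⟨g, g'⟩)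
        · exact Or.inl rfl
        · exact Or.inr ⟨g, g'⟩
        · exact Or.inr ⟨h, h'⟩
        · exact Or.inr ⟨h, g'⟩ }

/-- The `k`-fold self smash product of `X`, with the quotient topology. -/
abbrev SmashPower {X : Type u} [TopologicalSpace X] (x₀ : X) (k : ℕ) : Type u :=
  Quotient (smashSetoid x₀ k)

/-- The basepoint of the `k`-fold smash product. -/
def SmashPower.base {X : Type u} [TopologicalSpace X] (x₀ : X) (k : ℕ) : SmashPower x₀ k :=
  Quotient.mk _ (KPow.mk fun _ => x₀)

/-- The reduced diagonal `x ↦ x ∧ ⋯ ∧ x`. -/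
def reducedDiagonal {X : Type u} [TopologicalSpace X] [CompactlyGeneratedSpace X] (x₀ : X)
    (k : ℕ) : C(X, SmashPower x₀ k) where
  toFun x := Quotient.mk _ (KPow.mk fun _ => x)
  continuous_toFun := continuous_quotient_mk'.comp
    (KPow.continuous_mk (continuous_pi fun _ => continuous_id))

/-- The weak LS-category of `X` is less than `k`: the `k`-fold reduced diagonal is null homotopic
(through pointed maps). -/
def WeakLSCategoryLT {X : Type u} [TopologicalSpace X] [CompactlyGeneratedSpace X] (x₀ : X)
    (k : ℕ) : Prop :=
  (reducedDiagonal x₀ k).HomotopicRel (ContinuousMap.const X (SmashPower.base x₀ k)) {x₀}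

/-! ### The James construction -/

/-- The single relation imposed on words in the James construction: the basepoint is the unit. -/
def jamesRel {X : Type u} (x₀ : X) (a b : FreeMonoid X) : Prop :=
  a = FreeMonoid.of x₀ ∧ b = 1

/-- The James construction `J(X)`: the free monoid on `X` modulo the relation that the basepoint
is the unit. -/
def James {X : Type u} (x₀ : X) : Type u :=
  PresentedMonoid (jamesRel x₀)

instance James.instMonoid {X : Type u} (x₀ : X) : Monoid (James x₀) :=
  inferInstanceAs (Monoid (PresentedMonoid (jamesRel x₀)))

/-- The point of `J(X)` represented by a tuple `(x₁, …, xₖ)`. -/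
def James.word {X : Type u} [TopologicalSpace X] (x₀ : X) (p : Σ k : ℕ, KPow X k) : James x₀ :=
  PresentedMonoid.mk (jamesRel x₀) (FreeMonoid.ofList (List.ofFn p.2.coord))

/-- `J(X)` has the quotient topology from the disjoint union of the powers `X ^ k`. -/
instance James.instTopologicalSpace {X : Type u} [TopologicalSpace X] (x₀ : X) :
    TopologicalSpace (James x₀) :=
  TopologicalSpace.coinduced (James.word x₀) inferInstance

theorem James.isQuotientMap_word {X : Type u} [TopologicalSpace X] (x₀ : X) :
    IsQuotientMap (James.word x₀) := by
  refine ⟨⟨rfl⟩, fun j => ?_⟩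
  obtain ⟨w, rfl⟩ := PresentedMonoid.surjective_mk (rels := jamesRel x₀) j
  refine ⟨⟨w.toList.length, KPow.mk w.toList.get⟩, ?_⟩
  exact congrArg (fun l => PresentedMonoid.mk (jamesRel x₀) (FreeMonoid.ofList l))
    (List.ofFn_get w.toList)

theorem James.continuous_word {X : Type u} [TopologicalSpace X] (x₀ : X) :
    Continuous (James.word x₀) :=
  (James.isQuotientMap_word x₀).continuous

/-- The canonical inclusion `E : X → J(X)`. -/
def James.E {X : Type u} [TopologicalSpace X] [CompactlyGeneratedSpace X] (x₀ : X) :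
    C(X, James x₀) where
  toFun x := PresentedMonoid.of (jamesRel x₀) x
  continuous_toFun := (James.continuous_word x₀).comp
    (continuous_sigmaMk.comp (KPow.continuous_mk (n := 1) (f := fun (x : X) _ => x)
      (continuous_pi fun _ => continuous_id)))

theorem James.E_base {X : Type u} [TopologicalSpace X] [CompactlyGeneratedSpace X] (x₀ : X) :
    James.E x₀ x₀ = 1 :=
  Quotient.sound (ConGen.Rel.of _ _ ⟨rfl, rfl⟩)

/-! ### Pointwise products of maps into the James construction -/

/-- The `i`-th letter of a word, with the basepoint in place of missing letters. -/
def James.letter {X : Type u} [TopologicalSpace X] (x₀ : X) (i : ℕ) (p : Σ k : ℕ, KPow X k) : X :=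
  if h : i < p.1 then p.2.coord ⟨i, h⟩ else x₀

theorem James.continuous_letter {X : Type u} [TopologicalSpace X] (x₀ : X) (i : ℕ) :
    Continuous (James.letter x₀ i) := by
  refine continuous_sigma fun k => ?_
  by_cases h : i < k
  · simpa [James.letter, h] using KPow.continuous_coord (X := X) ⟨i, h⟩
  · simpa [James.letter, h] using continuous_const

theorem James.word_mul_word {X : Type u} [TopologicalSpace X] (x₀ : X)
    (p q : Σ k : ℕ, KPow X k) : James.word x₀ p * James.word x₀ q =
      James.word x₀ ⟨p.1 + q.1, KPow.mk (Fin.append (fun i : Fin p.1 => James.letter x₀ i p)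
        (fun i : Fin q.1 => James.letter x₀ i q))⟩ := by
  have hp : (fun i : Fin p.1 => James.letter x₀ i p) = p.2.coord := by
    funext i; simp [James.letter]
  have hq : (fun i : Fin q.1 => James.letter x₀ i q) = q.2.coord := by
    funext i; simp [James.letter]
  rw [hp, hq]
  have key : List.ofFn (KPow.mk (Fin.append p.2.coord q.2.coord)).coord =
      List.ofFn p.2.coord ++ List.ofFn q.2.coord :=
    List.ofFn_fin_append p.2.coord q.2.coord
  unfold James.word
  rw [key, FreeMonoid.ofList_append]
  exact (map_mul (PresentedMonoid.mk (jamesRel x₀)) _ _).symm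

theorem James.continuous_word_mul_word {X : Type u} [TopologicalSpace X] (x₀ : X) {K : Type u}
    [TopologicalSpace K] [CompactSpace K] [T2Space K] {a b : K → Σ k : ℕ, KPow X k}
    (ha : Continuous a) (hb : Continuous b) :
    Continuous fun k => James.word x₀ (a k) * James.word x₀ (b k) := by
  have hfst : Continuous fun p : Σ k : ℕ, KPow X k => p.1 :=
    continuous_sigma fun k => continuous_const
  have hlen : Continuous fun k => ((a k).1, (b k).1) := (hfst.comp ha).prodMk (hfst.comp hb)
  rw [continuous_iff_continuousAt]
  intro k₀
  let S : Set K := (fun k => ((a k).1, (b k).1)) ⁻¹' {((a k₀).1, (b k₀).1)}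
  have hSo : IsOpen S := (isOpen_discrete _).preimage hlen
  have hSc : IsClosed S := (isClosed_discrete _).preimage hlen
  have hS : CompactSpace S := isCompact_iff_compactSpace.mp hSc.isCompact
  have hcont : ContinuousOn (fun k => James.word x₀ (a k) * James.word x₀ (b k)) S := by
    rw [continuousOn_iff_continuous_domRestrict]
    have h1 : Continuous fun k : S =>
        James.word x₀ ⟨(a k₀).1 + (b k₀).1, KPow.mk (Fin.append
          (fun i : Fin (a k₀).1 => James.letter x₀ i (a k))
          (fun i : Fin (b k₀).1 => James.letter x₀ i (b k)))⟩ := by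
      refine (James.continuous_word x₀).comp (continuous_sigmaMk.comp
        (KPow.continuous_comp_mk (continuous_pi fun i => ?_)))
      refine Fin.addCases (fun i => ?_) (fun i => ?_) i
      · simpa [Function.comp_def] using
          (James.continuous_letter x₀ i).comp (ha.comp continuous_subtype_val)
      · simpa [Function.comp_def] using
          (James.continuous_letter x₀ i).comp (hb.comp continuous_subtype_val)
    refine h1.congr fun k => ?_
    obtain ⟨k, hk⟩ := k
    have hk' : ((a k).1, (b k).1) = ((a k₀).1, (b k₀).1) := hk
    rw [Prod.mk.injEq] at hk'
    rw [Set.domRestrict_apply, James.word_mul_word, ← hk'.1, ← hk'.2]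
  exact hcont.continuousAt (hSo.mem_nhds rfl)

theorem James.continuous_mul_of_compact {X : Type u} [TopologicalSpace X] (x₀ : X) {K : Type u}
    [TopologicalSpace K] [CompactSpace K] [T2Space K] {f g : K → James x₀}
    (hf : Continuous f) (hg : Continuous g) : Continuous fun k => f k * g k := by
  have step1 : ∀ {L : Type u} [TopologicalSpace L] [CompactSpace L] [T2Space L]
      {a : L → Σ k : ℕ, KPow X k}, Continuous a →
      Continuous fun p : L × James x₀ => James.word x₀ (a p.1) * p.2 := by
    intro L _ _ _ a ha
    refine (James.isQuotientMap_word x₀).continuous_lift_prod_right ?_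
    have hF : ∀ p, Continuous fun l => James.word x₀ (a l) * James.word x₀ p := fun p =>
      James.continuous_word_mul_word x₀ ha continuous_const
    let F : (Σ k : ℕ, KPow X k) → C(L, James x₀) := fun p => ⟨_, hF p⟩
    have hFc : Continuous F := by
      refine continuous_from_compactlyGeneratedSpace F fun M _ _ _ b hb => ?_
      refine ContinuousMap.continuous_of_continuous_uncurry _ ?_
      exact James.continuous_word_mul_word x₀ (K := M × L) (ha.comp continuous_snd)
        (hb.comp continuous_fst)
    exact (ContinuousMap.continuous_uncurry_of_continuous ⟨F, hFc⟩).comp continuous_swap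
  have step2 : Continuous fun p : James x₀ × K => p.1 * g p.2 := by
    refine (James.isQuotientMap_word x₀).continuous_lift_prod_left ?_
    have hF : ∀ p, Continuous fun k => James.word x₀ p * g k := fun p =>
      (step1 (L := PUnit) (a := fun _ => p) continuous_const).comp
        (continuous_const.prodMk hg : Continuous fun k => (PUnit.unit, g k))
    let F : (Σ k : ℕ, KPow X k) → C(K, James x₀) := fun p => ⟨_, hF p⟩
    have hFc : Continuous F := by
      refine continuous_from_compactlyGeneratedSpace F fun L _ _ _ a ha => ?_
      refine ContinuousMap.continuous_of_continuous_uncurry _ ?_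
      exact (step1 ha).comp (continuous_fst.prodMk (hg.comp continuous_snd) :
        Continuous fun p : L × K => (p.1, g p.2))
    exact ContinuousMap.continuous_uncurry_of_continuous ⟨F, hFc⟩
  exact step2.comp (hf.prodMk continuous_id)

theorem James.continuous_mul {X : Type u} [TopologicalSpace X] (x₀ : X) {Z : Type u}
    [TopologicalSpace Z] [CompactlyGeneratedSpace Z] {f g : Z → James x₀}
    (hf : Continuous f) (hg : Continuous g) : Continuous fun z => f z * g z :=
  continuous_from_compactlyGeneratedSpace _ fun K _ _ _ _ hk =>
    James.continuous_mul_of_compact x₀ (K := K) (hf.comp hk) (hg.comp hk)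

theorem James.continuous_mul_prod {X : Type u} [TopologicalSpace X] (x₀ : X) {Z : Type u}
    [TopologicalSpace Z] [CompactlyGeneratedSpace Z] {f g : I × Z → James x₀}
    (hf : Continuous f) (hg : Continuous g) : Continuous fun p => f p * g p := by
  have hF : ∀ z, Continuous fun t : I => f (t, z) * g (t, z) := fun z =>
    (James.continuous_mul x₀ (Z := ULift.{u} I)
      (f := fun t => f (t.down, z)) (g := fun t => g (t.down, z))
      (hf.comp (continuous_uliftDown.prodMk continuous_const))
      (hg.comp (continuous_uliftDown.prodMk continuous_const))).comp continuous_uliftUp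
  let F : Z → C(I, James x₀) := fun z => ⟨_, hF z⟩
  have hFc : Continuous F := by
    refine continuous_from_compactlyGeneratedSpace F fun K _ _ _ k hk => ?_
    refine ContinuousMap.continuous_of_continuous_uncurry _ ?_
    have hs : Continuous fun p : K × I => (p.2, k p.1) :=
      continuous_snd.prodMk (hk.comp continuous_fst)
    exact James.continuous_mul_of_compact x₀ (K := K × I) (hf.comp hs) (hg.comp hs)
  exact (ContinuousMap.continuous_uncurry_of_continuous ⟨F, hFc⟩).comp continuous_swap

/-! ### Pointed homotopy classes -/

/-- Pointed maps `(Z, z₀) → (J(X), 1)`. -/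
def PointedMap {X : Type u} [TopologicalSpace X] {Z : Type u} [TopologicalSpace Z] (z₀ : Z)
    (x₀ : X) : Type u :=
  {f : C(Z, James x₀) // f z₀ = 1}

/-- Pointed homotopy of pointed maps `Z → J(X)`. -/
instance PointedMap.setoid {X : Type u} [TopologicalSpace X] {Z : Type u} [TopologicalSpace Z]
    (z₀ : Z) (x₀ : X) : Setoid (PointedMap z₀ x₀) where
  r f g := f.1.HomotopicRel g.1 {z₀}
  iseqv := ⟨fun f => .refl f.1, fun h => h.symm, fun h h' => h.trans h'⟩

/-- The set `[Z, J(X)]` of pointed homotopy classes of pointed maps. -/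
def HomotopyClass {X : Type u} [TopologicalSpace X] {Z : Type u} [TopologicalSpace Z] (z₀ : Z)
    (x₀ : X) : Type u :=
  Quotient (PointedMap.setoid z₀ x₀)

instance PointedMap.instMonoid {X : Type u} [TopologicalSpace X] {Z : Type u}
    [TopologicalSpace Z] [CompactlyGeneratedSpace Z] (z₀ : Z) (x₀ : X) :
    Monoid (PointedMap z₀ x₀) where
  mul f g := ⟨⟨fun z => f.1 z * g.1 z, James.continuous_mul x₀ f.1.continuous g.1.continuous⟩, by
    change f.1 z₀ * g.1 z₀ = 1
    rw [f.2, g.2, one_mul]⟩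
  one := ⟨ContinuousMap.const Z 1, rfl⟩
  mul_assoc f g h := Subtype.ext (ContinuousMap.ext fun z => mul_assoc (f.1 z) (g.1 z) (h.1 z))
  one_mul f := Subtype.ext (ContinuousMap.ext fun z => one_mul (f.1 z))
  mul_one f := Subtype.ext (ContinuousMap.ext fun z => mul_one (f.1 z))

theorem PointedMap.mul_homotopic {X : Type u} [TopologicalSpace X] {Z : Type u}
    [TopologicalSpace Z] [CompactlyGeneratedSpace Z] {z₀ : Z} {x₀ : X}
    {f f' g g' : PointedMap z₀ x₀} (hf : f ≈ f') (hg : g ≈ g') : f * g ≈ f' * g' := by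
  obtain ⟨F⟩ := hf
  obtain ⟨G⟩ := hg
  refine ⟨⟨⟨⟨fun p => F p * G p, James.continuous_mul_prod x₀ F.continuous G.continuous⟩,
    fun z => ?_, fun z => ?_⟩, fun t z hz => ?_⟩⟩
  · change F (0, z) * G (0, z) = f.1 z * g.1 z
    rw [F.apply_zero, G.apply_zero]
  · change F (1, z) * G (1, z) = f'.1 z * g'.1 z
    rw [F.apply_one, G.apply_one]
  · change F (t, z) * G (t, z) = f.1 z * g.1 z
    rw [F.eq_fst t hz, G.eq_fst t hz]

/-- Pointwise multiplication in `J(X)` makes `[Z, J(X)]` a monoid. -/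
instance HomotopyClass.instMonoid {X : Type u} [TopologicalSpace X] {Z : Type u}
    [TopologicalSpace Z] [CompactlyGeneratedSpace Z] (z₀ : Z) (x₀ : X) :
    Monoid (HomotopyClass z₀ x₀) where
  mul := Quotient.map₂ (· * ·) fun _ _ hf _ _ hg => PointedMap.mul_homotopic hf hg
  one := Quotient.mk _ 1
  mul_assoc := by
    rintro ⟨f⟩ ⟨g⟩ ⟨h⟩
    exact congrArg (Quotient.mk _) (mul_assoc f g h)
  one_mul := by
    rintro ⟨f⟩
    exact congrArg (Quotient.mk _) (one_mul f)
  mul_one := by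
    rintro ⟨f⟩
    exact congrArg (Quotient.mk _) (mul_one f)

/-! ### The geometric Cohen group -/

/-- The monoid `[Xⁿ, J(X)]`. -/
abbrev PowerClass {X : Type u} [TopologicalSpace X] (x₀ : X) (n : ℕ) : Type u :=
  HomotopyClass (Z := KPow X n) (KPow.mk fun _ => x₀) x₀

/-- The pointed map `E ∘ pᵢ : Xⁿ → X → J(X)`. -/
def coordinateMap {X : Type u} [TopologicalSpace X] [CompactlyGeneratedSpace X] (x₀ : X) {n : ℕ}
    (i : Fin n) : PointedMap (Z := KPow X n) (KPow.mk fun _ => x₀) x₀ :=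
  ⟨(James.E x₀).comp ⟨fun x => x.coord i, KPow.continuous_coord i⟩, James.E_base x₀⟩

/-- The class of `E ∘ pᵢ` in `[Xⁿ, J(X)]`. -/
def coordinateClass {X : Type u} [TopologicalSpace X] [CompactlyGeneratedSpace X] (x₀ : X) {n : ℕ}
    (i : Fin n) : PowerClass x₀ n :=
  Quotient.mk _ (coordinateMap x₀ i)

/-- `Kₙ(X)`: the subgroup generated by the classes of `E ∘ pᵢ` in the group of invertible elements
of the monoid `[Xⁿ, J(X)]`. -/
def GeometricCohenGroup {X : Type u} [TopologicalSpace X] [CompactlyGeneratedSpace X] (x₀ : X)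
    (n : ℕ) : Subgroup (PowerClass x₀ n)ˣ :=
  Subgroup.closure {c | ∃ i : Fin n, (c : PowerClass x₀ n) = coordinateClass x₀ i}

/-! ### The combinatorial Cohen group -/

/-- The commutator `[x, y] = x⁻¹ y⁻¹ x y`. -/
def cohenCommutator {G : Type*} [Group G] (x y : G) : G :=
  x⁻¹ * y⁻¹ * x * y

/-- The iterated commutator `[⋯[[a₁, a₂], a₃], ⋯, aₗ]` (which is `a₁` for `l = 1`). -/
def iteratedCommutator {G : Type*} [Group G] : List G → G
  | [] => 1
  | a :: l => l.foldl cohenCommutator a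

/-- The defining relators of Cohen's group: iterated commutators of generators with a repeated
index, and multilinearity of iterated commutators in integral powers of the generators. -/
def cohenRelators (n : ℕ) : Set (FreeGroup (Fin n)) :=
  {r | ∃ l : List (Fin n), ¬ l.Nodup ∧ r = iteratedCommutator (l.map FreeGroup.of)} ∪
  {r | ∃ l : List (Fin n × ℤ),
    r = iteratedCommutator (l.map fun p => FreeGroup.of p.1 ^ p.2) *
      (iteratedCommutator (l.map fun p => FreeGroup.of p.1) ^ (l.map Prod.snd).prod)⁻¹}

/-- Cohen's combinatorial group `Kₙ`. -/
abbrev CohenGroup (n : ℕ) : Type :=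
  PresentedGroup (cohenRelators n)

end

/-!
The basepoint has a collar: a neighbourhood that contracts to it inside `X`. A null homotopy of the
reduced diagonal then covers the complement of the basepoint by countably many cozero sets that
contract inside `X`. As in Dold's theorem on local homotopy equivalences, the right inverses of `E`
that these contractions give locally are glued to a map `y : X → J(X)` with `E · y` null homotopic.
Carrying the null homotopies along as Moore paths makes `x₁ ⋯ xₖ ↦ y(xₖ) ⋯ y(x₁)` a right inverse
of the identity of `J(X)`, so every monoid `[Z, J(X)]` is a group.

If `a, b ∈ [Xⁿ, J(X)]` become trivial on the hyperplane `zᵢ = *`, then `ab` and `ba` differ by a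
map that factors through the reduced diagonal of the `i`-th coordinate, whence `ab = ba`. The kernel
of the restriction to each hyperplane is therefore an abelian normal subgroup, the `i`-th one
contains `[E ∘ pᵢ]`, and Cohen's relations hold among elements of abelian normal subgroups.
-/

universe v

noncomputable section

theorem compactlyGeneratedSpace_prod_of_locallyCompact (Z : Type u) (W : Type v)
    [TopologicalSpace Z] [CompactlyGeneratedSpace Z] [TopologicalSpace W] [LocallyCompactSpace W]
    [T2Space W] : CompactlyGeneratedSpace (Z × W) := by
  refine compactlyGeneratedSpace_of_continuous_maps fun {Y} _ f hf => ?_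
  have hK (K : Type u) [TopologicalSpace K] [CompactSpace K] [T2Space K] (g : K → Z)
      (hg : Continuous g) : Continuous fun p : K × W => f (g p.1, p.2) :=
    continuous_from_compactlyGeneratedSpace _ fun L _ _ _ l hl =>
      hf L (fun x => (g (l x).1, (l x).2)) (by fun_prop)
  let F (z : Z) : C(W, Y) := ⟨fun w => f (z, w),
    (hK PUnit (fun _ => z) continuous_const).comp (Continuous.prodMk_right PUnit.unit)⟩
  have hF : Continuous F := continuous_from_compactlyGeneratedSpace F fun K _ _ _ g hg =>
    ContinuousMap.continuous_of_continuous_uncurry _ (hK K g hg)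
  exact ContinuousMap.continuous_uncurry_of_continuous ⟨F, hF⟩

instance compactlyGeneratedSpace_prod_real (Z : Type u) [TopologicalSpace Z]
    [CompactlyGeneratedSpace Z] : CompactlyGeneratedSpace (Z × ℝ) :=
  compactlyGeneratedSpace_prod_of_locallyCompact Z ℝ

theorem compactlyGeneratedSpace_iff_isGeneratedBy (Z : Type u) [TopologicalSpace Z] :
    CompactlyGeneratedSpace Z ↔ IsGeneratedBy (fun K : CompHaus.{u} => (K : Type u)) Z := by
  refine ⟨fun _ => ⟨?_⟩, fun _ => compactlyGeneratedSpace_of_isOpen fun s hs => ?_⟩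
  · refine continuous_from_compactlyGeneratedSpace _ fun K _ _ _ g hg => ?_
    exact (IsGeneratedBy.equiv_symm_comp_continuous_iff
      (X := fun K : CompHaus.{u} => (K : Type u)) (Y := (CompHaus.of K : CompHaus.{u})) g).2 hg
  · exact (IsGeneratedBy.isOpen_iff fun K : CompHaus.{u} => (K : Type u)).2 fun K f =>
      hs K f f.continuous

theorem compactlyGeneratedSpace_subtype_of_isOpen {Z : Type u} [TopologicalSpace Z]
    [CompactlyGeneratedSpace Z] {V : Set Z} (hV : IsOpen V) : CompactlyGeneratedSpace V := by
  have opens_compact (K : Type u) [TopologicalSpace K] [CompactSpace K] [T2Space K]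
      (U : TopologicalSpace.Opens K) : CompactlyGeneratedSpace U :=
    have := U.isOpen.locallyCompactSpace
    inferInstance
  have (K : CompHaus.{u}) (U : TopologicalSpace.Opens K) :
      IsGeneratedBy (fun K : CompHaus.{u} => (K : Type u)) U :=
    (compactlyGeneratedSpace_iff_isGeneratedBy U).1 (opens_compact K U)
  have := (compactlyGeneratedSpace_iff_isGeneratedBy Z).1 inferInstance
  exact (compactlyGeneratedSpace_iff_isGeneratedBy V).2 hV.isGeneratedBy

theorem James.continuousOn_mul {X : Type u} [TopologicalSpace X] {x₀ : X} {Z : Type u}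
    [TopologicalSpace Z] [CompactlyGeneratedSpace Z] {f g : Z → James x₀} {V : Set Z}
    (hV : IsOpen V) (hf : ContinuousOn f V) (hg : ContinuousOn g V) :
    ContinuousOn (fun z => f z * g z) V := by
  have := compactlyGeneratedSpace_subtype_of_isOpen hV
  rw [continuousOn_iff_continuous_domRestrict] at *
  exact James.continuous_mul x₀ hf hg

instance James.compactlyGeneratedSpace {X : Type u} [TopologicalSpace X] (x₀ : X) :
    CompactlyGeneratedSpace (James x₀) :=
  compactlyGeneratedSpace_of_coinduced (James.continuous_word x₀) rfl

/-- A path `γ`, parametrised by `ℝ`, is stationary at `a` up to time `0` and at `b` from time `1`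
on. Parametrising paths by `ℝ` lets them be reparametrised without truncating to the unit
interval. -/
structure HasEndpoints {Y : Type*} (γ : ℝ → Y) (a b : Y) : Prop where
  left : ∀ t ≤ 0, γ t = a
  right : ∀ t, 1 ≤ t → γ t = b

/-- `K` is a homotopy over `V` from `f` to `g`, each of whose tracks is parametrised by `ℝ` as in
`HasEndpoints`. -/
structure IsHomotopyOn {X Y : Type*} [TopologicalSpace X] [TopologicalSpace Y] (V : Set X)
    (f g : X → Y) (K : X → ℝ → Y) : Prop where
  continuousOn : ContinuousOn (fun p : X × ℝ => K p.1 p.2) (V ×ˢ Set.univ)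
  hasEndpoints : ∀ x ∈ V, HasEndpoints (K x) (f x) (g x)

theorem IsHomotopyOn.mono {X Y : Type*} [TopologicalSpace X] [TopologicalSpace Y] {V V' : Set X}
    {f g : X → Y} {K : X → ℝ → Y} (hK : IsHomotopyOn V f g K) (h : V' ⊆ V) :
    IsHomotopyOn V' f g K :=
  ⟨hK.continuousOn.mono (Set.prod_mono_left h), fun x hx => hK.hasEndpoints x (h hx)⟩

theorem IsHomotopyOn.continuous {X Y : Type*} [TopologicalSpace X] [TopologicalSpace Y]
    {f g : X → Y} {K : X → ℝ → Y} (hK : IsHomotopyOn Set.univ f g K) :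
    Continuous fun p : X × ℝ => K p.1 p.2 := by
  simpa only [Set.univ_prod_univ, continuousOn_univ] using hK.continuousOn

theorem exists_isHomotopyOn_of_homotopicRel {X Y : Type*} [TopologicalSpace X]
    [TopologicalSpace Y] {f g : C(X, Y)} {a : X} (h : f.HomotopicRel g {a}) :
    ∃ H : X → ℝ → Y, IsHomotopyOn Set.univ f g H ∧ ∀ t, H a t = f a := by
  obtain ⟨H⟩ := h
  refine ⟨fun x t => H (Set.projIcc 0 1 zero_le_one t, x), ⟨Continuous.continuousOn ?_,
    fun x _ => ⟨fun t ht => ?_, fun t ht => ?_⟩⟩, fun t => H.eq_fst _ rfl⟩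
  · exact H.continuous.comp ((continuous_projIcc.comp continuous_snd).prodMk continuous_fst)
  · exact H.toHomotopy.extend_apply_of_le_zero ht x
  · exact H.toHomotopy.extend_apply_of_one_le ht x

theorem IsHomotopyOn.comp_left {X Y Y' : Type*} [TopologicalSpace X] [TopologicalSpace Y]
    [TopologicalSpace Y'] {V : Set X} {f g : X → Y} {K : X → ℝ → Y} (hK : IsHomotopyOn V f g K)
    {φ : Y → Y'} (hφ : Continuous φ) :
    IsHomotopyOn V (φ ∘ f) (φ ∘ g) fun x t => φ (K x t) where
  continuousOn := hφ.comp_continuousOn hK.continuousOn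
  hasEndpoints x hx :=
    ⟨fun t ht => congrArg φ ((hK.hasEndpoints x hx).left t ht),
      fun t ht => congrArg φ ((hK.hasEndpoints x hx).right t ht)⟩

/-! ### Collars of the basepoint -/

/-- The NDR structure of a nondegenerate basepoint: a real function `v` vanishing exactly at the
basepoint and a deformation `h`, parametrised by `ℝ` as in `HasEndpoints`, that collapses the
neighbourhood `{v < 1}` to the basepoint. -/
structure Collar {X : Type u} [TopologicalSpace X] (x₀ : X) where
  v : X → ℝ
  h : X → ℝ → X
  continuous_v : Continuous v
  v_nonneg : ∀ x, 0 ≤ v x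
  v_le_one : ∀ x, v x ≤ 1
  v_eq_zero_iff : ∀ x, v x = 0 ↔ x = x₀
  continuous_h : Continuous fun p : X × ℝ => h p.1 p.2
  h_of_nonpos : ∀ x, ∀ t ≤ 0, h x t = x
  h_base : ∀ t, h x₀ t = x₀
  h_of_one_le : ∀ x, v x < 1 → ∀ t, 1 ≤ t → h x t = x₀

attribute [fun_prop] Collar.continuous_v

@[fun_prop]
theorem Collar.continuous_h_comp {X : Type u} [TopologicalSpace X] {x₀ : X} (c : Collar x₀)
    {Z : Type*} [TopologicalSpace Z] {f : Z → X} {t : Z → ℝ} (hf : Continuous f)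
    (ht : Continuous t) : Continuous fun z => c.h (f z) (t z) :=
  c.continuous_h.comp₂ hf ht

theorem NondegenerateBasepoint.nonempty_collar {X : Type u} [TopologicalSpace X] {x₀ : X}
    (hx₀ : NondegenerateBasepoint x₀) : Nonempty (Collar x₀) := by
  obtain ⟨v, h, hv, h_zero, h_base, h_one⟩ := hx₀
  exact ⟨{
    v x := v x
    h x t := h (x, Set.projIcc 0 1 zero_le_one t)
    continuous_v := by fun_prop
    v_nonneg x := (v x).2.1
    v_le_one x := (v x).2.2
    v_eq_zero_iff x := by rw [← hv, Set.Icc.coe_eq_zero]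
    continuous_h := h.continuous.comp
      (continuous_fst.prodMk (continuous_projIcc.comp continuous_snd))
    h_of_nonpos x t ht := by
      rw [Set.projIcc_of_le_left _ ht]
      exact h_zero x
    h_base t := h_base _
    h_of_one_le x hx t ht := by
      rw [Set.projIcc_of_right_le _ ht]
      exact h_one x (by exact_mod_cast hx) }⟩

namespace Collar

variable {X : Type u} [TopologicalSpace X] {x₀ : X} (c : Collar x₀)

@[simp]
theorem v_base : c.v x₀ = 0 :=
  (c.v_eq_zero_iff x₀).2 rfl

theorem isHomotopyOn_h : IsHomotopyOn {x | c.v x < 1} id (fun _ => x₀) c.h where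
  continuousOn := c.continuous_h.continuousOn
  hasEndpoints x hx := ⟨c.h_of_nonpos x, c.h_of_one_le x hx⟩

end Collar

/-! ### Homotopy classes -/

namespace HomotopyClass

variable {X : Type u} [TopologicalSpace X] {x₀ : X} {Z : Type u} [TopologicalSpace Z] {z₀ : Z}

/-- The class of a pointed map. -/
def mk (f : PointedMap z₀ x₀) : HomotopyClass z₀ x₀ :=
  Quotient.mk _ f

theorem mk_surjective : Function.Surjective (mk : PointedMap z₀ x₀ → HomotopyClass z₀ x₀) :=
  Quotient.mk_surjective

theorem mk_eq_mk_of_homotopy {f g : PointedMap z₀ x₀} (H : Z → ℝ → James x₀)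
    (continuous_H : Continuous fun p : Z × ℝ => H p.1 p.2) (H_zero : ∀ z, H z 0 = f.1 z)
    (H_one : ∀ z, H z 1 = g.1 z) (H_base : ∀ t, H z₀ t = 1) : mk f = mk g := by
  refine Quotient.sound ⟨⟨⟨⟨fun p => H p.2 p.1, ?_⟩, H_zero, H_one⟩, ?_⟩⟩
  · exact continuous_H.comp₂ continuous_snd (by fun_prop)
  · rintro t z rfl
    exact (H_base t).trans f.2.symm

theorem exists_homotopy_of_mk_eq_mk {f g : PointedMap z₀ x₀} (h : mk f = mk g) :
    ∃ H : Z → ℝ → James x₀, IsHomotopyOn Set.univ f.1 g.1 H ∧ ∀ t, H z₀ t = 1 := by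
  obtain ⟨H, hH, H_base⟩ := exists_isHomotopyOn_of_homotopicRel (Quotient.exact h)
  exact ⟨H, hH, fun t => (H_base t).trans f.2⟩

end HomotopyClass

theorem exists_rat_lt_and_forall_pos {f : ℝ → ℝ} (hf : Continuous f) (h0 : 0 < f 0)
    (h1 : f 1 ≤ 0) {ε : ℝ} (hε : 0 < ε) :
    ∃ q : ℚ, 0 ≤ q ∧ f q < ε ∧ ∀ t ∈ Set.Icc (0 : ℝ) q, 0 < f t := by
  obtain ⟨δ, δ_pos, δ_lt⟩ := exists_between (lt_min hε h0)
  obtain ⟨hδε, hδ0⟩ := lt_min_iff.1 δ_lt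
  have hS : IsCompact (Set.Icc 0 1 ∩ {t | f t ≤ δ}) :=
    isCompact_Icc.inter_right (isClosed_le hf continuous_const)
  obtain ⟨r, ⟨hr, hfr⟩, hmin⟩ := hS.exists_isLeast ⟨1, by simp, h1.trans δ_pos.le⟩
  have hr0 : 0 < r := hr.1.lt_of_ne fun h => (h ▸ hfr : f 0 ≤ δ).not_gt hδ0
  have near_r : ∀ᶠ t in 𝓝[<] r, f t < ε ∧ t ∈ Set.Ioo 0 r :=
    (((hf.tendsto r).eventually_lt_const (hfr.trans_lt hδε)).filter_mono
      nhdsWithin_le_nhds).and (Ioo_mem_nhdsLT hr0)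
  obtain ⟨q, hfq, hq, hqr⟩ := Rat.denseRange_cast.exists_mem_open
    ((isOpen_lt hf continuous_const).inter isOpen_Ioo) near_r.exists
  refine ⟨q, by exact_mod_cast hq.le, hfq, fun t ht => ?_⟩
  have htr : t < r := ht.2.trans_lt hqr
  by_contra! hft
  exact htr.not_ge (hmin ⟨⟨ht.1, htr.le.trans hr.2⟩, hft.trans δ_pos.le⟩)

namespace Collar

variable {X : Type u} [TopologicalSpace X] {x₀ : X} (c : Collar x₀)

theorem min_v_eq_zero_iff {p : KPow X 2} :
    min (c.v (p.coord 0)) (c.v (p.coord 1)) = 0 ↔ ∃ i, p.coord i = x₀ := by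
  rw [Fin.exists_fin_two, ← c.v_eq_zero_iff, ← c.v_eq_zero_iff]
  grind [c.v_nonneg (p.coord 0), c.v_nonneg (p.coord 1)]

/-- The function on `X ∧ X` vanishing exactly at the basepoint that the collar induces. -/
def smashMin : SmashPower x₀ 2 → ℝ :=
  Quotient.lift (fun p => min (c.v (p.coord 0)) (c.v (p.coord 1))) (by
    rintro p q (rfl | ⟨hp, hq⟩)
    · rfl
    · rw [c.min_v_eq_zero_iff.2 hp, c.min_v_eq_zero_iff.2 hq])

open Classical in
/-- The `j`-th coordinate of a point of `X ∧ X`; it is continuous away from the basepoint. -/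
def smashCoord (x₀ : X) (j : Fin 2) : SmashPower x₀ 2 → X :=
  Quotient.lift (fun p => if ∃ i, p.coord i = x₀ then x₀ else p.coord j) (by
    rintro p q (rfl | ⟨hp, hq⟩)
    · rfl
    · rw [if_pos hp, if_pos hq])

theorem continuous_smashMin : Continuous c.smashMin :=
  Continuous.quotient_lift ((c.continuous_v.comp (KPow.continuous_coord 0)).min
    (c.continuous_v.comp (KPow.continuous_coord 1))) _

theorem smashCoord_mk {j : Fin 2} {p : KPow X 2}
    (hp : 0 < c.smashMin (Quotient.mk _ p)) : smashCoord x₀ j (Quotient.mk _ p) = p.coord j :=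
  if_neg fun h => hp.ne' (c.min_v_eq_zero_iff.2 h)

theorem continuousOn_smashCoord (j : Fin 2) :
    ContinuousOn (smashCoord x₀ j) {q | 0 < c.smashMin q} := by
  have hopen : IsOpen {q | 0 < c.smashMin q} := isOpen_lt continuous_const c.continuous_smashMin
  refine (isQuotientMap_quotient_mk'.continuousOn_isOpen_iff hopen).2 ?_
  exact (KPow.continuous_coord j).continuousOn.congr fun p hp => c.smashCoord_mk hp

theorem smashMin_reducedDiagonal [CompactlyGeneratedSpace X] (x : X) :
    c.smashMin (reducedDiagonal x₀ 2 x) = c.v x :=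
  min_self _

theorem smashCoord_reducedDiagonal [CompactlyGeneratedSpace X] {j : Fin 2} {x : X}
    (hx : 0 < c.v x) : smashCoord x₀ j (reducedDiagonal x₀ 2 x) = x :=
  c.smashCoord_mk (p := KPow.mk fun _ => x) (lt_min hx hx)

theorem smashMin_base : c.smashMin (SmashPower.base x₀ 2) = 0 :=
  c.min_v_eq_zero_iff.2 ⟨0, rfl⟩

theorem exists_v_smashCoord_lt_one {q : SmashPower x₀ 2} (h0 : 0 < c.smashMin q)
    (h1 : c.smashMin q < 1) : ∃ j, c.v (smashCoord x₀ j q) < 1 := by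
  induction q using Quotient.inductionOn with
  | h p =>
    simp only [c.smashCoord_mk h0]
    exact (min_lt_iff.1 h1).elim (⟨0, ·⟩) (⟨1, ·⟩)

/-- A continuous function on `X ∧ X` that is positive exactly where the `j`-th coordinate lies in
the collar; the factor `smashMin` makes it continuous at the basepoint. -/
def smashSide (j : Fin 2) (q : SmashPower x₀ 2) : ℝ :=
  c.smashMin q * (1 - c.v (smashCoord x₀ j q))

theorem continuous_smashSide (j : Fin 2) : Continuous (c.smashSide j) := by
  refine isQuotientMap_quotient_mk'.continuous_iff.2 ?_
  change Continuous fun p : KPow X 2 => c.smashSide j (Quotient.mk _ p)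
  have hmk : Continuous fun p : KPow X 2 => c.smashMin (Quotient.mk _ p) :=
    c.continuous_smashMin.comp continuous_quotient_mk'
  have hv : Continuous fun p : KPow X 2 => c.v (p.coord j) :=
    c.continuous_v.comp (KPow.continuous_coord j)
  refine (hmk.mul (continuous_const.sub hv : Continuous fun p => 1 - c.v (p.coord j))).congr
    fun p => ?_
  rcases eq_or_ne (c.smashMin (Quotient.mk _ p)) 0 with h | h
  · simp [smashSide, h]
  · have hpos : 0 < c.smashMin (Quotient.mk _ p) :=
      (le_min (c.v_nonneg _) (c.v_nonneg _)).lt_of_ne' h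
    simp [smashSide, c.smashCoord_mk hpos]

/-- The minimal distance to the basepoint of `X ∧ X` along the track of `x` up to time `q`. -/
def trackMin (G : X → ℝ → SmashPower x₀ 2) (q : ℝ) (x : X) : ℝ :=
  sInf ((fun t => c.smashMin (G x t)) '' Set.Icc 0 q)

/-- Follow the `j`-th coordinate of the track of `x` in `X ∧ X` until time `q`, and then the
collar. -/
def trackContraction (G : X → ℝ → SmashPower x₀ 2) (q : ℝ) (j : Fin 2) (x : X) (t : ℝ) : X :=
  c.h (smashCoord x₀ j (G x (min (2 * t) 1 * q))) (2 * t - 1)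

/-- The open set on which `trackContraction` contracts is the set where this function is
positive. -/
def trackWeight (G : X → ℝ → SmashPower x₀ 2) (q : ℝ) (j : Fin 2) (x : X) : ℝ :=
  min (c.trackMin G q x) (c.smashSide j (G x q))

variable {G : X → ℝ → SmashPower x₀ 2} (hG : Continuous fun p : X × ℝ => G p.1 p.2)
include hG

theorem continuous_trackWeight (q : ℝ) (j : Fin 2) : Continuous (c.trackWeight G q j) :=
  (isCompact_Icc.continuous_sInf (c.continuous_smashMin.comp hG)).min
    ((c.continuous_smashSide j).comp (hG.comp₂ continuous_id continuous_const))

theorem trackMin_pos_iff {q : ℝ} (hq : 0 ≤ q) (x : X) :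
    0 < c.trackMin G q x ↔ ∀ t ∈ Set.Icc 0 q, 0 < c.smashMin (G x t) := by
  have hc : Continuous fun t => c.smashMin (G x t) :=
    c.continuous_smashMin.comp (hG.comp₂ continuous_const continuous_id)
  obtain ⟨t, ht, ht_min, hmin⟩ := isCompact_Icc.exists_sInf_image_eq_and_le
    (Set.nonempty_Icc.2 hq) hc.continuousOn
  have heq : c.trackMin G q x = c.smashMin (G x t) := ht_min
  exact heq ▸ ⟨fun h s hs => h.trans_le (hmin s hs), fun h => h t ht⟩

variable [CompactlyGeneratedSpace X]
  (hΔ : ∀ x, HasEndpoints (G x) (reducedDiagonal x₀ 2 x) (SmashPower.base x₀ 2))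
include hΔ

theorem isHomotopyOn_trackContraction {q : ℝ} (hq : 0 ≤ q) (j : Fin 2) :
    IsHomotopyOn {x | 0 < c.trackWeight G q j x} id (fun _ => x₀) (c.trackContraction G q j) := by
  have smashMin_pos {x : X} (hx : 0 < c.trackWeight G q j x) {s : ℝ} (hs : s ≤ q) :
      0 < c.smashMin (G x s) := by
    have hpos := (c.trackMin_pos_iff hG hq x).1 (lt_min_iff.1 hx).1
    rcases le_total 0 s with h | h
    · exact hpos s ⟨h, hs⟩
    · rw [(hΔ x).left s h, ← (hΔ x).left 0 le_rfl]
      exact hpos 0 ⟨le_rfl, hq⟩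
  have v_pos {x : X} (hx : 0 < c.trackWeight G q j x) : 0 < c.v x := by
    simpa [(hΔ x).left 0 le_rfl, c.smashMin_reducedDiagonal] using smashMin_pos hx hq
  have v_lt_one {x : X} (hx : 0 < c.trackWeight G q j x) : c.v (smashCoord x₀ j (G x q)) < 1 :=
    sub_pos.1 (pos_of_mul_pos_right (lt_min_iff.1 hx).2 (smashMin_pos hx le_rfl).le)
  refine ⟨?_, fun x hx => ⟨fun t ht => ?_, fun t ht => ?_⟩⟩
  · have hcoord : ContinuousOn (fun p : X × ℝ => smashCoord x₀ j (G p.1 (min (2 * p.2) 1 * q)))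
        ({x | 0 < c.trackWeight G q j x} ×ˢ Set.univ) :=
      (c.continuousOn_smashCoord j).comp
        (hG.comp₂ continuous_fst
          (by fun_prop : Continuous fun p : X × ℝ => min (2 * p.2) 1 * q)).continuousOn
        fun p hp => smashMin_pos hp.1 (mul_le_of_le_one_left hq (min_le_right _ _))
    exact c.continuous_h.comp_continuousOn (hcoord.prodMk
      (by fun_prop : Continuous fun p : X × ℝ => 2 * p.2 - 1).continuousOn)
  · have : min (2 * t) 1 * q ≤ 0 :=
      mul_nonpos_of_nonpos_of_nonneg (min_le_of_left_le (by linarith)) hq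
    rw [trackContraction, c.h_of_nonpos _ _ (by linarith), (hΔ x).left _ this,
      c.smashCoord_reducedDiagonal (v_pos hx), id]
  · rw [trackContraction, min_eq_right (by linarith), one_mul,
      c.h_of_one_le _ (v_lt_one hx) _ (by linarith)]

theorem exists_trackWeight_pos {x : X} (hx : 0 < c.v x) :
    ∃ q : ℚ, 0 ≤ q ∧ ∃ j, 0 < c.trackWeight G q j x := by
  have hc : Continuous fun t => c.smashMin (G x t) :=
    c.continuous_smashMin.comp (hG.comp₂ continuous_const continuous_id)
  obtain ⟨q, hq, hlt, hpos⟩ := exists_rat_lt_and_forall_pos hc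
    (by rwa [(hΔ x).left 0 le_rfl, c.smashMin_reducedDiagonal])
    (by rw [(hΔ x).right 1 le_rfl, c.smashMin_base]) one_pos
  have hq' : (0 : ℝ) ≤ q := by exact_mod_cast hq
  have hq_pos := hpos q ⟨hq', le_rfl⟩
  obtain ⟨j, hj⟩ := c.exists_v_smashCoord_lt_one hq_pos hlt
  exact ⟨q, hq, j, lt_min ((c.trackMin_pos_iff hG hq' x).2 hpos) (mul_pos hq_pos (sub_pos.2 hj))⟩

end Collar

theorem WeakLSCategoryLT.exists_contractible_cover {X : Type u} [TopologicalSpace X]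
    [CompactlyGeneratedSpace X] {x₀ : X} (hcat : WeakLSCategoryLT x₀ 2) (c : Collar x₀) :
    ∃ (w : ℕ → X → ℝ) (K : ℕ → X → ℝ → X), (∀ k, Continuous (w k)) ∧
      (∀ k, IsHomotopyOn {x | 0 < w k x} id (fun _ => x₀) (K k)) ∧
      ∀ x, 0 < c.v x → ∃ k, 1 < w k x := by
  obtain ⟨G, hG, -⟩ := exists_isHomotopyOn_of_homotopicRel hcat
  have hΔ (x : X) : HasEndpoints (G x) (reducedDiagonal x₀ 2 x) (SmashPower.base x₀ 2) :=
    hG.hasEndpoints x trivial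
  obtain ⟨e, he⟩ := exists_surjective_nat (ℚ≥0 × Fin 2 × ℕ)
  let q (k : ℕ) : ℝ := (e k).1
  let j (k : ℕ) : Fin 2 := (e k).2.1
  refine ⟨fun k x => (e k).2.2 * c.trackWeight G (q k) (j k) x,
    fun k => c.trackContraction G (q k) (j k),
    fun k => continuous_const.mul (c.continuous_trackWeight hG.continuous _ _), fun k => ?_,
    fun x hx => ?_⟩
  · exact (c.isHomotopyOn_trackContraction hG.continuous hΔ (NNRat.cast_nonneg _) (j k)).mono
      fun x hx => pos_of_mul_pos_right (b := c.trackWeight G (q k) (j k) x) hx (Nat.cast_nonneg _)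
  · obtain ⟨r, hr, i, hpos⟩ := c.exists_trackWeight_pos hG.continuous hΔ hx
    lift r to ℚ≥0 using hr
    obtain ⟨n, hn⟩ := Archimedean.arch 2 hpos
    obtain ⟨k, hk⟩ := he (r, i, n)
    refine ⟨k, one_lt_two.trans_le ?_⟩
    simpa [q, j, hk] using hn

/-- `s` is a right inverse of `e` over `V` up to homotopy: it consists of a map `x ↦ (s x).1` and a
homotopy `x ↦ (s x).2` from `x ↦ e x * (s x).1` to the constant map `1`. -/
structure IsRightInverseOn {X : Type u} [TopologicalSpace X] {x₀ : X} (e : X → James x₀)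
    (V : Set X) (s : X → James x₀ × (ℝ → James x₀)) : Prop where
  continuousOn : ContinuousOn (fun x => (s x).1) V
  isHomotopyOn : IsHomotopyOn V (fun x => e x * (s x).1) 1 fun x => (s x).2

namespace IsRightInverseOn

variable {X : Type u} [TopologicalSpace X] {x₀ : X} {e : X → James x₀} {V V' : Set X}
  {s s' : X → James x₀ × (ℝ → James x₀)}

theorem mono (hs : IsRightInverseOn e V s) (h : V' ⊆ V) : IsRightInverseOn e V' s :=
  ⟨hs.continuousOn.mono h, hs.isHomotopyOn.mono h⟩

theorem congr (hs : IsRightInverseOn e V s) (h : Set.EqOn s' s V) : IsRightInverseOn e V s' where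
  continuousOn := hs.continuousOn.congr fun x hx => congrArg Prod.fst (h hx)
  isHomotopyOn :=
    ⟨hs.isHomotopyOn.continuousOn.congr fun p hp => congrArg (fun q => q.2 p.2) (h hp.1),
      fun x hx => by simpa only [h hx] using hs.isHomotopyOn.hasEndpoints x hx⟩

theorem of_locally (h : ∀ x ∈ V, ∃ U, IsOpen U ∧ x ∈ U ∧ IsRightInverseOn e U s) :
    IsRightInverseOn e V s where
  continuousOn x hx := by
    obtain ⟨U, hU, hxU, hs⟩ := h x hx
    exact (hs.continuousOn.continuousAt (hU.mem_nhds hxU)).continuousWithinAt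
  isHomotopyOn.continuousOn p hp := by
    obtain ⟨U, hU, hxU, hs⟩ := h p.1 hp.1
    exact (hs.isHomotopyOn.continuousOn.continuousAt
      ((hU.prod isOpen_univ).mem_nhds ⟨hxU, trivial⟩)).continuousWithinAt
  isHomotopyOn.hasEndpoints x hx := by
    obtain ⟨U, -, hxU, hs⟩ := h x hx
    exact hs.isHomotopyOn.hasEndpoints x hxU

theorem of_isHomotopyOn_one {K : X → ℝ → James x₀} (hK : IsHomotopyOn V e 1 K) :
    IsRightInverseOn e V fun x => (1, K x) where
  continuousOn := continuousOn_const
  isHomotopyOn := by simpa only [mul_one] using hK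

end IsRightInverseOn

/-! ### Interpolation between right inverses -/

/-- If `K` is a path from `a` to `1` and `p` consists of a right inverse `y` of `a` together with a
path from `a * y` to `1`, then this is a path from `y` at time `0` to `1` at time `2`. -/
def inversePath {M : Type*} [Monoid M] (K : ℝ → M) (p : M × (ℝ → M)) (r : ℝ) : M :=
  if r ≤ 1 then K (1 - r) * p.1 else p.2 (r - 1)

/-- A path of right inverses of `a`, each with a path from its product with `a` to `1`, leading from
`p` at `θ = -1` to `(1, K)` at `θ = 2`. From `θ = 0` on the inverse moves along `inversePath`, and
its path to `1` contracts `a` along `K` and then follows the rest of `inversePath`; from `θ = -1` to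
`θ = 0` the detour along `K` and back, which that path makes at `θ = 0`, is created. -/
def interpolate {M : Type*} [Monoid M] (K : ℝ → M) (p : M × (ℝ → M)) (θ : ℝ) : M × (ℝ → M) :=
  (inversePath K p (max θ 0), fun t =>
    if t * (3 + min θ 0 - |θ|) ≤ 1 + min θ 0 then
      K (t * (3 + min θ 0 - |θ|)) * inversePath K p (max θ 0)
    else inversePath K p (|θ| + t * (3 + min θ 0 - |θ|) - (1 + min θ 0)))

section Interpolate

variable {M : Type*} [Monoid M] {a : M} {K : ℝ → M} {p : M × (ℝ → M)}

theorem inversePath_zero (hK : HasEndpoints K a 1) : inversePath K p 0 = p.1 := by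
  rw [inversePath, if_pos zero_le_one, hK.right _ (by norm_num), one_mul]

theorem inversePath_of_one_le (hK : HasEndpoints K a 1) (hp : HasEndpoints p.2 (a * p.1) 1) {r : ℝ}
    (hr : 1 ≤ r) : inversePath K p r = p.2 (r - 1) := by
  rcases hr.eq_or_lt with rfl | hr
  · rw [inversePath, if_pos le_rfl, hK.left _ (by norm_num), hp.left _ (by norm_num)]
  · rw [inversePath, if_neg hr.not_ge]

theorem inversePath_of_two_le (hK : HasEndpoints K a 1) (hp : HasEndpoints p.2 (a * p.1) 1) {r : ℝ}
    (hr : 2 ≤ r) : inversePath K p r = 1 := by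
  rw [inversePath_of_one_le hK hp (by linarith), hp.right _ (by linarith)]

theorem interpolate_neg_one (hK : HasEndpoints K a 1) (hp : HasEndpoints p.2 (a * p.1) 1) :
    interpolate K p (-1) = p := by
  refine Prod.ext ?_ (funext fun t => ?_)
  · simpa [interpolate] using inversePath_zero hK
  · norm_num [interpolate]
    split_ifs with ht
    · rw [hK.left t ht, hp.left t ht, inversePath_zero hK]
    · rw [inversePath_of_one_le hK hp (by linarith), add_sub_cancel_left]

theorem interpolate_two (hK : HasEndpoints K a 1) (hp : HasEndpoints p.2 (a * p.1) 1) :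
    interpolate K p 2 = (1, K) := by
  refine Prod.ext ?_ (funext fun t => ?_)
  · simpa [interpolate] using inversePath_of_two_le hK hp le_rfl
  · norm_num [interpolate]
    split_ifs with ht
    · rw [inversePath_of_two_le hK hp le_rfl, mul_one]
    · rw [hK.right t (by linarith), inversePath_of_two_le hK hp (by linarith)]

theorem hasEndpoints_interpolate (hK : HasEndpoints K a 1) (hp : HasEndpoints p.2 (a * p.1) 1)
    {θ : ℝ} (hθ : θ ∈ Set.Icc (-1) 2) :
    HasEndpoints (interpolate K p θ).2 (a * (interpolate K p θ).1) 1 := by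
  obtain ⟨hθ1, hθ2⟩ := hθ
  have h_min : 0 ≤ 1 + min θ 0 := by grind
  have h_len : 1 ≤ 3 + min θ 0 - |θ| := by grind
  refine ⟨fun t ht => ?_, fun t ht => ?_⟩
  · have hT : t * (3 + min θ 0 - |θ|) ≤ 0 := mul_nonpos_of_nonpos_of_nonneg ht (by linarith)
    simp only [interpolate, if_pos (hT.trans h_min), hK.left _ hT]
  · have hT : 3 + min θ 0 - |θ| ≤ t * (3 + min θ 0 - |θ|) :=
      le_mul_of_one_le_left (by linarith) ht
    simp only [interpolate]
    split_ifs with h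
    · rw [hK.right _ (by linarith), one_mul, inversePath_of_two_le hK hp (by grind)]
    · exact inversePath_of_two_le hK hp (by linarith)

end Interpolate

section Continuity

variable {X : Type u} [TopologicalSpace X] [CompactlyGeneratedSpace X] {x₀ : X}
  {e : X → James x₀} {V : Set X} {s : X → James x₀ × (ℝ → James x₀)} {K : X → ℝ → James x₀}

theorem continuousOn_inversePath (hV : IsOpen V) (hs : IsRightInverseOn e V s)
    (hK : IsHomotopyOn V e 1 K) :
    ContinuousOn (fun p : X × ℝ => inversePath (K p.1) (s p.1) p.2) (V ×ˢ Set.univ) := by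
  have h_before : ContinuousOn (fun p : X × ℝ => K p.1 (1 - p.2) * (s p.1).1) (V ×ˢ Set.univ) :=
    James.continuousOn_mul (hV.prod isOpen_univ)
      (hK.continuousOn.comp (f := fun p : X × ℝ => (p.1, 1 - p.2)) (by fun_prop)
        fun p hp => ⟨hp.1, trivial⟩)
      (hs.continuousOn.comp continuousOn_fst fun p hp => hp.1)
  have h_after : ContinuousOn (fun p : X × ℝ => (s p.1).2 (p.2 - 1)) (V ×ˢ Set.univ) :=
    hs.isHomotopyOn.continuousOn.comp (f := fun p : X × ℝ => (p.1, p.2 - 1)) (by fun_prop)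
      fun p hp => ⟨hp.1, trivial⟩
  refine ContinuousOn.if ?_ (h_before.mono Set.inter_subset_left)
    (h_after.mono Set.inter_subset_left)
  rintro ⟨x, r⟩ ⟨⟨hx, -⟩, hr⟩
  obtain rfl : r = 1 := frontier_le_subset_eq continuous_snd continuous_const hr
  simp only [sub_self, (hK.hasEndpoints x hx).left 0 le_rfl,
    (hs.isHomotopyOn.hasEndpoints x hx).left 0 le_rfl]

theorem IsRightInverseOn.interpolate (hV : IsOpen V) (hs : IsRightInverseOn e V s)
    (hK : IsHomotopyOn V e 1 K) {θ : X → ℝ} (hθ : Continuous θ)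
    (hθ_mem : ∀ x, θ x ∈ Set.Icc (-1) 2) :
    IsRightInverseOn e V fun x => interpolate (K x) (s x) (θ x) := by
  have hη := continuousOn_inversePath hV hs hK
  have h_fst : ContinuousOn (fun x => inversePath (K x) (s x) (max (θ x) 0)) V :=
    hη.comp (f := fun x => (x, max (θ x) 0)) (by fun_prop) fun x hx => ⟨hx, trivial⟩
  refine ⟨h_fst, ?_, fun x hx => hasEndpoints_interpolate (hK.hasEndpoints x hx)
    (hs.isHomotopyOn.hasEndpoints x hx) (hθ_mem x)⟩
  let T (p : X × ℝ) : ℝ := p.2 * (3 + min (θ p.1) 0 - |θ p.1|)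
  have hT : Continuous T := by fun_prop
  have h_before : ContinuousOn (fun p : X × ℝ => K p.1 (T p) * inversePath (K p.1) (s p.1)
      (max (θ p.1) 0)) (V ×ˢ Set.univ) :=
    James.continuousOn_mul (hV.prod isOpen_univ)
      (hK.continuousOn.comp (f := fun p : X × ℝ => (p.1, T p)) (by fun_prop)
        fun p hp => ⟨hp.1, trivial⟩)
      (h_fst.comp continuousOn_fst fun p hp => hp.1)
  have h_after : ContinuousOn (fun p : X × ℝ => inversePath (K p.1) (s p.1)
      (|θ p.1| + T p - (1 + min (θ p.1) 0))) (V ×ˢ Set.univ) :=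
    hη.comp (f := fun p : X × ℝ => (p.1, |θ p.1| + T p - (1 + min (θ p.1) 0))) (by fun_prop)
      fun p hp => ⟨hp.1, trivial⟩
  refine ContinuousOn.if ?_ (h_before.mono Set.inter_subset_left)
    (h_after.mono Set.inter_subset_left)
  rintro p ⟨⟨hx, -⟩, hp⟩
  have hTp : T p = 1 + min (θ p.1) 0 :=
    frontier_le_subset_eq hT (by fun_prop : Continuous fun p : X × ℝ => 1 + min (θ p.1) 0) hp
  have hKp := hK.hasEndpoints p.1 hx
  change K p.1 (T p) * _ = inversePath (K p.1) (s p.1) (|θ p.1| + T p - (1 + min (θ p.1) 0))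
  rw [hTp, add_sub_cancel_right]
  rcases le_total 0 (θ p.1) with h | h
  · rw [min_eq_right h, add_zero, hKp.right 1 le_rfl, Pi.one_apply, one_mul, max_eq_left h,
      abs_of_nonneg h]
  · rw [min_eq_left h, max_eq_right h, inversePath_zero hKp, abs_of_nonpos h, inversePath,
      if_pos (by linarith [(hθ_mem p.1).1]), sub_neg_eq_add]

end Continuity

/-! ### Gluing right inverses over a countable cover -/

theorem one_lt_sub_div_sub_iff {a b b' : ℝ} (h : b < b') : 1 < (a - b) / (b' - b) ↔ b' < a := by
  rw [one_lt_div (sub_pos.2 h), sub_lt_sub_iff_right]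

theorem sub_div_sub_pos_iff {a b b' : ℝ} (h : b < b') : 0 < (a - b) / (b' - b) ↔ b < a := by
  rw [div_pos_iff_of_pos_right (sub_pos.2 h), sub_pos]

section Gluing

variable {X : Type u} [TopologicalSpace X] {x₀ : X} {e : X → James x₀}

open Classical in
/-- The extension of a right inverse `s` over `{0 < ρ}` by the right inverse `(1, K)` over `W`; it
agrees with `s` on `{1 < ρ}`. -/
def extendRightInverse (s : X → James x₀ × (ℝ → James x₀)) (ρ : X → ℝ) (W : Set X)
    (K : X → ℝ → James x₀) (x : X) : James x₀ × (ℝ → James x₀) :=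
  if x ∈ W then
    if 0 < ρ x then interpolate (K x) (s x) (max (-1) (min 2 (5 - 6 * ρ x))) else (1, K x)
  else s x

variable {s : X → James x₀ × (ℝ → James x₀)} {ρ : X → ℝ} {W : Set X} {K : X → ℝ → James x₀}

theorem eqOn_extendRightInverse (hs : IsRightInverseOn e {x | 0 < ρ x} s)
    (hK : IsHomotopyOn W e 1 K) : Set.EqOn (extendRightInverse s ρ W K) s {x | 1 < ρ x} := by
  intro x (hx : 1 < ρ x)
  have hx0 : 0 < ρ x := one_pos.trans hx
  by_cases hxW : x ∈ W
  · rw [extendRightInverse, if_pos hxW, if_pos hx0, max_eq_left (min_le_of_right_le (by linarith)),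
      interpolate_neg_one (hK.hasEndpoints x hxW) (hs.isHomotopyOn.hasEndpoints x hx0)]
  · rw [extendRightInverse, if_neg hxW]

variable [CompactlyGeneratedSpace X]

theorem IsRightInverseOn.extend (hρ : Continuous ρ) (hs : IsRightInverseOn e {x | 0 < ρ x} s)
    (hW : IsOpen W) (hK : IsHomotopyOn W e 1 K) :
    IsRightInverseOn e ({x | 1 < ρ x} ∪ W) (extendRightInverse s ρ W K) := by
  refine of_locally fun x hx => ?_
  rcases lt_or_ge 1 (ρ x) with h1 | h1
  · exact ⟨{x | 1 < ρ x}, isOpen_lt continuous_const hρ, h1,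
      (hs.mono fun y (hy : 1 < ρ y) => one_pos.trans hy).congr (eqOn_extendRightInverse hs hK)⟩
  have hxW : x ∈ W := hx.resolve_left h1.not_gt
  rcases lt_or_ge 0 (ρ x) with h0 | h0
  · have hU : IsOpen ({x | 0 < ρ x} ∩ W) := (isOpen_lt continuous_const hρ).inter hW
    refine ⟨_, hU, ⟨h0, hxW⟩, ((hs.mono Set.inter_subset_left).interpolate hU
      (hK.mono Set.inter_subset_right) (θ := fun x => max (-1) (min 2 (5 - 6 * ρ x)))
      (by fun_prop) fun y => ⟨le_max_left _ _, by norm_num⟩).congr fun y ⟨hy, hyW⟩ => ?_⟩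
    exact (if_pos hyW).trans (if_pos hy)
  · refine ⟨{x | ρ x < 1 / 2} ∩ W, (isOpen_lt hρ continuous_const).inter hW,
      ⟨h0.trans_lt one_half_pos, hxW⟩,
      (of_isHomotopyOn_one (hK.mono Set.inter_subset_right)).congr fun y ⟨hy, hyW⟩ => ?_⟩
    have hy' : ρ y < 1 / 2 := hy
    rw [extendRightInverse, if_pos hyW]
    split_ifs with h
    · rw [min_eq_left (by linarith), max_eq_right (by norm_num),
        interpolate_two (hK.hasEndpoints y hyW) (hs.isHomotopyOn.hasEndpoints y h)]
    · rfl

/-- The right inverse over the first `k + 1` members of a cover; `b` is an increasing sequence of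
thresholds, by which the domain shrinks slightly at each step. -/
def partialRightInverse (w : ℕ → X → ℝ) (K : ℕ → X → ℝ → James x₀) (b : ℕ → ℝ) :
    ℕ → X → James x₀ × (ℝ → James x₀)
  | 0 => fun x => (1, K 0 x)
  | k + 1 => extendRightInverse (partialRightInverse w K b k)
      (fun x => (partialSups w k x - b k) / (b (k + 1) - b k)) {x | 0 < w (k + 1) x} (K (k + 1))

variable {w : ℕ → X → ℝ} {K : ℕ → X → ℝ → James x₀} {b : ℕ → ℝ}

theorem isRightInverseOn_partialRightInverse (hw : ∀ k, Continuous (w k))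
    (hK : ∀ k, IsHomotopyOn {x | 0 < w k x} e 1 (K k)) (hb : StrictMono b) (hb0 : ∀ k, 0 < b k)
    (k : ℕ) :
    IsRightInverseOn e {x | b k < partialSups w k x} (partialRightInverse w K b k) := by
  induction k with
  | zero => exact (IsRightInverseOn.of_isHomotopyOn_one (hK 0)).mono fun x hx => (hb0 0).trans hx
  | succ k ih =>
    have hρ : Continuous fun x => (partialSups w k x - b k) / (b (k + 1) - b k) :=
      ((Continuous.partialSups fun i _ => hw i).sub continuous_const).div_const _
    refine (IsRightInverseOn.extend hρ
      (ih.mono fun x => (sub_div_sub_pos_iff (hb k.lt_succ_self)).1)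
      (isOpen_lt continuous_const (hw (k + 1))) (hK (k + 1))).mono fun x hx => ?_
    have hx' : b (k + 1) < partialSups w (k + 1) x := hx
    rw [partialSups_add_one, Pi.sup_apply, lt_sup_iff] at hx'
    exact hx'.imp (one_lt_sub_div_sub_iff (hb k.lt_succ_self)).2 (hb0 (k + 1)).trans

theorem eqOn_partialRightInverse_succ (hw : ∀ k, Continuous (w k))
    (hK : ∀ k, IsHomotopyOn {x | 0 < w k x} e 1 (K k)) (hb : StrictMono b) (hb0 : ∀ k, 0 < b k)
    (k : ℕ) : Set.EqOn (partialRightInverse w K b (k + 1)) (partialRightInverse w K b k)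
      {x | b (k + 1) < partialSups w k x} := fun _ hx =>
  eqOn_extendRightInverse ((isRightInverseOn_partialRightInverse hw hK hb hb0 k).mono
    fun _ => (sub_div_sub_pos_iff (hb k.lt_succ_self)).1) (hK (k + 1))
    ((one_lt_sub_div_sub_iff (hb k.lt_succ_self)).2 hx)

/-- Dold's gluing argument: where one member of the cover is large, only finitely many extensions
change the right inverse, so that their limit exists. -/
theorem exists_isRightInverseOn_univ (hw : ∀ k, Continuous (w k))
    (hK : ∀ k, IsHomotopyOn {x | 0 < w k x} e 1 (K k)) (hcover : ∀ x, ∃ k, 1 < w k x) :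
    ∃ s, IsRightInverseOn e Set.univ s ∧ ∀ x, 1 < w 0 x → s x = (1, K 0 x) := by
  obtain ⟨b, hb, hb_mem, -⟩ := exists_seq_strictMono_tendsto' (zero_lt_one (α := ℝ))
  have hS := isRightInverseOn_partialRightInverse hw hK hb fun k => (hb_mem k).1
  have hS_succ := eqOn_partialRightInverse_succ hw hK hb fun k => (hb_mem k).1
  set S := partialRightInverse w K b
  have stable {k n : ℕ} (hkn : k ≤ n) {x : X} (hx : 1 < partialSups w k x) : S n x = S k x := by
    induction n, hkn using Nat.le_induction with
    | base => rfl
    | succ n hkn ih =>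
      refine (hS_succ n ?_).trans ih
      exact ((hb_mem (n + 1)).2.trans hx).trans_le ((partialSups w).monotone hkn x)
  choose N hN using hcover
  have large {k : ℕ} {x : X} (hx : 1 < w k x) : 1 < partialSups w k x :=
    hx.trans_le (le_partialSups w k x)
  have limit {k : ℕ} {x : X} (hx : 1 < partialSups w k x) : S (N x) x = S k x := by
    rw [← stable (le_max_left (N x) k) (large (hN x)), stable (le_max_right (N x) k) hx]
  refine ⟨fun x => S (N x) x, .of_locally fun x _ => ?_, fun x hx => limit (large hx)⟩
  exact ⟨{y | 1 < partialSups w (N x) y},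
    isOpen_lt continuous_const (Continuous.partialSups fun i _ => hw i), large (hN x),
    ((hS (N x)).mono fun y hy => (hb_mem _).2.trans hy).congr fun y hy => limit hy⟩

end Gluing

theorem exists_right_inverse_E {X : Type u} [TopologicalSpace X] [CompactlyGeneratedSpace X]
    {x₀ : X} (hcat : WeakLSCategoryLT x₀ 2) (c : Collar x₀) :
    ∃ s, IsRightInverseOn (James.E x₀) Set.univ s ∧ s x₀ = (1, fun _ => 1) := by
  obtain ⟨w, K, hw, hK, hcover⟩ := hcat.exists_contractible_cover c
  have hE : James.E x₀ ∘ (fun _ : X => x₀) = 1 := funext fun _ => James.E_base x₀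
  let w' : ℕ → X → ℝ
    | 0 => fun x => 2 * (1 - c.v x)
    | k + 1 => w k
  let K' : ℕ → X → ℝ → James x₀
    | 0 => fun x t => James.E x₀ (c.h x t)
    | k + 1 => fun x t => James.E x₀ (K k x t)
  have hw' : ∀ k, Continuous (w' k)
    | 0 => continuous_const.mul (continuous_const.sub c.continuous_v)
    | k + 1 => hw k
  have hK' : ∀ k, IsHomotopyOn {x | 0 < w' k x} (James.E x₀) 1 (K' k)
    | 0 => hE ▸ (c.isHomotopyOn_h.comp_left (James.E x₀).continuous).mono fun x hx =>
        sub_pos.1 (pos_of_mul_pos_right (b := 1 - c.v x) hx zero_le_two)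
    | k + 1 => hE ▸ (hK k).comp_left (James.E x₀).continuous
  have hcover' (x : X) : ∃ k, 1 < w' k x := by
    rcases (c.v_nonneg x).eq_or_lt with h | h
    · exact ⟨0, by norm_num [w', ← h]⟩
    · exact (hcover x h).imp' Nat.succ fun k hk => hk
  obtain ⟨s, hs, hs0⟩ := exists_isRightInverseOn_univ hw' hK' hcover'
  refine ⟨s, hs, (hs0 x₀ (by norm_num [w'])).trans ?_⟩
  simp only [K', c.h_base, James.E_base]

/-! ### Extending right inverses to words -/

namespace James

variable {X : Type u} {x₀ : X}

/-- The point of `J(X)` represented by a list of points of `X`. -/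
def ofList (x₀ : X) (l : List X) : James x₀ :=
  PresentedMonoid.mk (jamesRel x₀) (FreeMonoid.ofList l)

theorem ofList_surjective : Function.Surjective (ofList x₀) :=
  PresentedMonoid.surjective_mk (rels := jamesRel x₀)

/-- The monoid homomorphism on `J(X)` extending a map that sends the basepoint to the unit. -/
def lift {M : Type*} [Monoid M] (f : X → M) (hf : f x₀ = 1) : James x₀ →* M :=
  PresentedMonoid.lift f (by
    rintro a b ⟨rfl, rfl⟩
    rw [FreeMonoid.lift_eval_of, hf, map_one])

section Lift

variable {M : Type*} [Monoid M] (f : X → M) (hf : f x₀ = 1)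

theorem lift_ofList_nil : lift f hf (ofList x₀ []) = 1 :=
  map_one (lift f hf)

theorem lift_ofList_cons (x : X) (l : List X) :
    lift f hf (ofList x₀ (x :: l)) = f x * lift f hf (ofList x₀ l) :=
  map_mul (lift f hf) (PresentedMonoid.of (jamesRel x₀) x) (ofList x₀ l)

end Lift

variable [TopologicalSpace X]

theorem continuous_of_ofList {W : Type v} [TopologicalSpace W] [LocallyCompactSpace W]
    {Y : Type*} [TopologicalSpace Y] {F : James x₀ × W → Y}
    (hF : ∀ {Z : Type u} [TopologicalSpace Z] [CompactlyGeneratedSpace Z] (L : List C(Z, X)),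
      Continuous fun p : Z × W => F (ofList x₀ (L.map fun f => f p.1), p.2)) : Continuous F := by
  refine (James.isQuotientMap_word x₀).continuous_lift_prod_left ?_
  rw [← Homeomorph.sigmaProdDistrib.symm.comp_continuous_iff']
  refine continuous_sigma fun k => ?_
  refine (hF (List.ofFn fun i : Fin k =>
    (⟨fun x => x.coord i, KPow.continuous_coord i⟩ : C(KPow X k, X)))).congr fun p => ?_
  rw [List.map_ofFn]
  rfl

end James

/-- A point of a monoid together with a Moore path: a path `path`, stationary from time `length` on,
that ends at the unit. The start `path 0` is unrelated to `point`. -/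
@[ext]
structure MoorePath (M : Type*) [One M] where
  point : M
  length : ℝ
  path : ℝ → M
  length_nonneg : 0 ≤ length
  path_of_length_le : ∀ t, length ≤ t → path t = 1

instance MoorePath.instOne {M : Type*} [One M] : One (MoorePath M) :=
  ⟨⟨1, 0, fun _ => 1, le_rfl, fun _ _ => rfl⟩⟩

/-- A homotopy `path` from the pointwise product of `g` and `k` to the constant map `1`, in which
the point `x` arrives at time `length x`. The length vanishes at the basepoint, so that the homotopy
can be iterated along words. -/
structure MooreNullHomotopy {X : Type u} [TopologicalSpace X] {x₀ : X} (g k : X → James x₀) where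
  length : X → ℝ
  path : X → ℝ → James x₀
  continuous_length : Continuous length
  continuous_path : Continuous fun p : X × ℝ => path p.1 p.2
  length_nonneg : ∀ x, 0 ≤ length x
  length_base : length x₀ = 0
  path_zero : ∀ x, path x 0 = g x * k x
  path_of_length_le : ∀ x t, length x ≤ t → path x t = 1

namespace MooreNullHomotopy

variable {X : Type u} [TopologicalSpace X] {x₀ : X} {g k : X → James x₀}
  (N : MooreNullHomotopy g k)

/-- Multiply a Moore path by `g x` on the left and `k x` on the right, and then follow the null
homotopy of `g x * k x`. -/
def act (x : X) : Function.End (MoorePath (James x₀)) := fun s =>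
  { point := s.point * k x
    length := s.length + N.length x
    path t := if t ≤ s.length then g x * s.path t * k x else N.path x (t - s.length)
    length_nonneg := add_nonneg s.length_nonneg (N.length_nonneg x)
    path_of_length_le := by
      intro t ht
      have h0 := N.length_nonneg x
      split_ifs with h
      · rw [s.path_of_length_le t (by linarith), mul_one, ← N.path_zero,
          N.path_of_length_le x 0 (by linarith)]
      · exact N.path_of_length_le x _ (by linarith) }

variable (hg : g x₀ = 1) (hk : k x₀ = 1)
include hg hk

theorem act_base : N.act x₀ = 1 := by
  funext s
  refine MoorePath.ext ?_ ?_ (funext fun t => ?_)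
  · exact (congrArg (s.point * ·) hk).trans (mul_one _)
  · exact (congrArg (s.length + ·) N.length_base).trans (add_zero _)
  · simp only [act, hg, hk, one_mul, mul_one]
    split_ifs with h
    · rfl
    · rw [N.path_of_length_le x₀ _ (by linarith [N.length_base])]
      exact (s.path_of_length_le t (by linarith)).symm

/-- The point `k xₙ * ⋯ * k x₁` together with the Moore path that contracts
`g x₁ * ⋯ * g xₙ * k xₙ * ⋯ * k x₁` from the middle, for the word `x₁ ⋯ xₙ`. -/
def wordPath (w : James x₀) : MoorePath (James x₀) :=
  James.lift N.act (N.act_base hg hk) w 1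

theorem wordPath_nil : N.wordPath hg hk (James.ofList x₀ []) = 1 := by
  rw [wordPath, James.lift_ofList_nil]
  rfl

theorem wordPath_cons (x : X) (l : List X) : N.wordPath hg hk (James.ofList x₀ (x :: l)) =
    N.act x (N.wordPath hg hk (James.ofList x₀ l)) := by
  rw [wordPath, James.lift_ofList_cons]
  rfl

theorem wordPath_path_zero (w : James x₀) : (N.wordPath hg hk w).path 0 =
    James.lift g hg w * (N.wordPath hg hk w).point := by
  obtain ⟨l, rfl⟩ := James.ofList_surjective w
  induction l with
  | nil => rw [wordPath_nil, James.lift_ofList_nil, one_mul]; rfl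
  | cons x l ih =>
    rw [wordPath_cons, James.lift_ofList_cons]
    simp only [act, if_pos (N.wordPath hg hk _).length_nonneg, ih, mul_assoc]

theorem continuous_wordPath_ofList (hgc : Continuous g) (hkc : Continuous k) {Z : Type u}
    [TopologicalSpace Z] [CompactlyGeneratedSpace Z] (L : List C(Z, X)) :
    (Continuous fun z => (N.wordPath hg hk (.ofList x₀ (L.map fun f => f z))).point) ∧
    (Continuous fun z => (N.wordPath hg hk (.ofList x₀ (L.map fun f => f z))).length) ∧
    Continuous fun p : Z × ℝ =>
      (N.wordPath hg hk (.ofList x₀ (L.map fun f => f p.1))).path p.2 := by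
  induction L with
  | nil =>
    simp only [List.map_nil, wordPath_nil]
    exact ⟨continuous_const, continuous_const, continuous_const⟩
  | cons f L ih =>
    obtain ⟨h_point, h_length, h_path⟩ := ih
    simp only [List.map_cons, wordPath_cons]
    refine ⟨James.continuous_mul x₀ h_point (hkc.comp f.continuous),
      h_length.add (N.continuous_length.comp f.continuous), ?_⟩
    refine Continuous.if_le ?_ ?_ continuous_snd (h_length.comp continuous_fst) fun p hp => ?_
    · exact James.continuous_mul x₀ (James.continuous_mul x₀
        (hgc.comp (f.continuous.comp continuous_fst)) h_path)
        (hkc.comp (f.continuous.comp continuous_fst))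
    · exact N.continuous_path.comp₂ (f.continuous.comp continuous_fst)
        (continuous_snd.sub (h_length.comp continuous_fst))
    · rw [hp, (N.wordPath hg hk _).path_of_length_le _ le_rfl, mul_one, sub_self, N.path_zero]

theorem continuous_wordPath (hgc : Continuous g) (hkc : Continuous k) :
    Continuous fun p : James x₀ × ℝ => ((N.wordPath hg hk p.1).point,
      (N.wordPath hg hk p.1).path (p.2 * (N.wordPath hg hk p.1).length)) :=
  James.continuous_of_ofList fun L =>
    have ⟨h_point, h_length, h_path⟩ := N.continuous_wordPath_ofList hg hk hgc hkc L
    (h_point.comp continuous_fst).prodMk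
      (h_path.comp (continuous_fst.prodMk (continuous_snd.mul (h_length.comp continuous_fst))))

end MooreNullHomotopy

namespace PointedMap

variable {X : Type u} [TopologicalSpace X] {x₀ : X} {Z : Type u} [TopologicalSpace Z] {z₀ : Z}
  {Z' : Type u} [TopologicalSpace Z'] {z₀' : Z'}

/-- The identity of `J(X)` as a pointed map. -/
def id (x₀ : X) : PointedMap (1 : James x₀) x₀ :=
  ⟨ContinuousMap.id _, rfl⟩

/-- The restriction of a pointed map along a pointed map of the source. -/
def comp (f : PointedMap z₀ x₀) (k : C(Z', Z)) (hk : k z₀' = z₀) : PointedMap z₀' x₀ :=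
  ⟨f.1.comp k, (congrArg f.1 hk).trans f.2⟩

end PointedMap

namespace HomotopyClass

variable {X : Type u} [TopologicalSpace X] {x₀ : X} {Z : Type u} [TopologicalSpace Z]
  [CompactlyGeneratedSpace Z] {z₀ : Z} {Z' : Type u} [TopologicalSpace Z']
  [CompactlyGeneratedSpace Z'] {z₀' : Z'}

/-- The homomorphism `[Z, J(X)] → [Z', J(X)]` induced by a pointed map `Z' → Z`. -/
def pullback (x₀ : X) (k : C(Z', Z)) (hk : k z₀' = z₀) :
    HomotopyClass z₀ x₀ →* HomotopyClass z₀' x₀ where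
  toFun := Quotient.map (fun f => f.comp k hk) fun f g ⟨H⟩ =>
    ⟨⟨⟨⟨fun p => H (p.1, k p.2), by fun_prop⟩, fun z => H.apply_zero (k z),
      fun z => H.apply_one (k z)⟩, by
      rintro t z rfl
      exact H.eq_fst t hk⟩⟩
  map_one' := rfl
  map_mul' := by
    rintro ⟨f⟩ ⟨g⟩
    rfl

end HomotopyClass

namespace Collar

variable {X : Type u} [TopologicalSpace X] [CompactlyGeneratedSpace X] {x₀ : X} (c : Collar x₀)

/-- The endomorphism of `J(X)` that the stage `t` of the deformation of a collar induces. -/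
def jamesMap (t : ℝ) : James x₀ →* James x₀ :=
  James.lift (fun x => James.E x₀ (c.h x t)) (by rw [c.h_base, James.E_base])

theorem jamesMap_zero (w : James x₀) : c.jamesMap 0 w = w := by
  have : c.jamesMap 0 = MonoidHom.id _ := PresentedMonoid.ext _ fun x =>
    congrArg (James.E x₀) (c.h_of_nonpos x 0 le_rfl)
  rw [this, MonoidHom.id_apply]

theorem continuous_jamesMap : Continuous fun p : James x₀ × ℝ => c.jamesMap p.2 p.1 := by
  refine James.continuous_of_ofList fun L => ?_
  induction L with
  | nil =>
    simp only [List.map_nil, jamesMap, James.lift_ofList_nil]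
    exact continuous_const
  | cons f L ih =>
    simp only [List.map_cons, jamesMap, James.lift_ofList_cons]
    exact James.continuous_mul x₀ (by fun_prop) ih

/-- Precomposed with the end of the collar deformation, the null homotopy of a right inverse of `E`
is constant over `{v < 1}`, where it can therefore be started later. -/
def mooreNullHomotopy {s : X → James x₀ × (ℝ → James x₀)}
    (hs : IsRightInverseOn (James.E x₀) Set.univ s) (hs₀ : s x₀ = (1, fun _ => 1)) :
    MooreNullHomotopy (fun x => James.E x₀ (c.h x 1)) fun x => (s (c.h x 1)).1 where
  length := c.v
  path x t := (s (c.h x 1)).2 (t + (1 - c.v x))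
  continuous_length := c.continuous_v
  continuous_path :=
    hs.isHomotopyOn.continuous.comp (f := fun p : X × ℝ => (c.h p.1 1, p.2 + (1 - c.v p.1)))
      (by fun_prop)
  length_nonneg := c.v_nonneg
  length_base := c.v_base
  path_zero x := by
    rcases (c.v_le_one x).lt_or_eq with h | h
    · rw [c.h_of_one_le x h 1 le_rfl, hs₀, James.E_base, one_mul]
    · exact (hs.isHomotopyOn.hasEndpoints _ trivial).left _ (by linarith)
  path_of_length_le x t ht :=
    (hs.isHomotopyOn.hasEndpoints _ trivial).right _ (by linarith)

end Collar

/-! ### The groups `[Z, J(X)]` -/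

theorem isUnit_of_forall_exists_mul_eq_one {M : Type*} [Monoid M] (h : ∀ a : M, ∃ b, a * b = 1)
    (a : M) : IsUnit a := by
  obtain ⟨b, hab⟩ := h a
  obtain ⟨d, hbd⟩ := h b
  obtain rfl : a = d := left_inv_eq_right_inv hab hbd
  exact ⟨⟨a, b, hab, hbd⟩, rfl⟩

namespace HomotopyClass

variable {X : Type u} [TopologicalSpace X] [CompactlyGeneratedSpace X] {x₀ : X}

theorem exists_mk_id_mul_eq_one (hcat : WeakLSCategoryLT x₀ 2) (c : Collar x₀) :
    ∃ b, mk (PointedMap.id x₀) * b = 1 := by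
  obtain ⟨s, hs, hs₀⟩ := exists_right_inverse_E hcat c
  let N := c.mooreNullHomotopy hs hs₀
  have hg : James.E x₀ (c.h x₀ 1) = 1 := by rw [c.h_base, James.E_base]
  have hk : (s (c.h x₀ 1)).1 = 1 := by rw [c.h_base, hs₀]
  have hN := N.continuous_wordPath hg hk (by fun_prop)
    ((continuousOn_univ.1 hs.continuousOn).comp (by fun_prop))
  have hN_one : N.wordPath hg hk 1 = 1 := N.wordPath_nil hg hk
  let ρ : PointedMap (1 : James x₀) x₀ := ⟨⟨c.jamesMap 1,
    c.continuous_jamesMap.comp₂ continuous_id continuous_const⟩, map_one (c.jamesMap 1)⟩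
  let χ : PointedMap (1 : James x₀) x₀ := ⟨⟨fun w => (N.wordPath hg hk w).point,
    hN.fst.comp (continuous_id.prodMk (continuous_const (y := (0 : ℝ))))⟩,
    congrArg MoorePath.point hN_one⟩
  have h_id : mk (PointedMap.id x₀) = mk ρ := mk_eq_mk_of_homotopy (fun w t => c.jamesMap t w)
    c.continuous_jamesMap c.jamesMap_zero (fun _ => rfl) fun _ => map_one _
  refine ⟨mk χ, h_id ▸ ?_⟩
  refine mk_eq_mk_of_homotopy (f := ρ * χ) (g := 1)
    (fun w t => (N.wordPath hg hk w).path (t * (N.wordPath hg hk w).length)) hN.snd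
    (fun w => ?_) (fun w => ?_) fun t => ?_
  · rw [zero_mul, N.wordPath_path_zero hg hk]
    rfl
  · exact (N.wordPath hg hk w).path_of_length_le _ (one_mul _).ge
  · rw [hN_one]
    rfl

theorem isUnit (hcat : WeakLSCategoryLT x₀ 2) (c : Collar x₀) {Z : Type u} [TopologicalSpace Z]
    [CompactlyGeneratedSpace Z] {z₀ : Z} (a : HomotopyClass z₀ x₀) : IsUnit a := by
  obtain ⟨b, hb⟩ := exists_mk_id_mul_eq_one hcat c
  refine isUnit_of_forall_exists_mul_eq_one (fun a => ?_) a
  obtain ⟨f, rfl⟩ := mk_surjective a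
  refine ⟨pullback x₀ f.1 f.2 b, ?_⟩
  calc mk f * pullback x₀ f.1 f.2 b
      = pullback x₀ f.1 f.2 (mk (PointedMap.id x₀) * b) :=
        (map_mul (pullback x₀ f.1 f.2) (mk (PointedMap.id x₀)) b).symm
    _ = 1 := by rw [hb, map_one]

end HomotopyClass

/-! ### Commuting classes on powers of `X` -/

namespace KPow

variable {X : Type u} [TopologicalSpace X] {n : ℕ}

/-- The point obtained from `z` by replacing the `i`-th coordinate by `x`. -/
def update (z : KPow X n) (i : Fin n) (x : X) : KPow X n :=
  mk (Function.update z.coord i x)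

theorem coord_update (z : KPow X n) (i : Fin n) (x : X) : (z.update i x).coord i = x :=
  Function.update_self (β := fun _ => X) i x z.coord

theorem update_coord (z : KPow X n) (i : Fin n) : z.update i (z.coord i) = z :=
  congrArg mk (Function.update_eq_self i z.coord)

theorem update_base (x₀ : X) (i : Fin n) :
    (mk fun _ => x₀ : KPow X n).update i x₀ = mk fun _ => x₀ :=
  update_coord (mk fun _ => x₀) i

theorem continuous_update {T : Type u} [TopologicalSpace T] [CompactlyGeneratedSpace T]
    {z : T → KPow X n} {x : T → X} (hz : Continuous z) (i : Fin n) (hx : Continuous x) :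
    Continuous fun t => (z t).update i (x t) :=
  continuous_mk ((WithGeneratedByTopology.continuous_equiv.comp hz).update i hx)

end KPow

/-- A map `z ↦ Θ (p z, …, p z) z` that extends over `X ∧ ⋯ ∧ X` in its first variable factors
through the reduced diagonal. -/
theorem WeakLSCategoryLT.mk_eq_one {X : Type u} [TopologicalSpace X] [CompactlyGeneratedSpace X]
    {x₀ : X} {k : ℕ} [NeZero k] (hcat : WeakLSCategoryLT x₀ k) {Z : Type u} [TopologicalSpace Z]
    [CompactlyGeneratedSpace Z] {z₀ : Z} {p : C(Z, X)} (hp : p z₀ = x₀)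
    {Θ : KPow X k → Z → James x₀}
    (continuous_Θ : ∀ {T : Type u} [TopologicalSpace T] [CompactlyGeneratedSpace T]
      {q : T → KPow X k} {z : T → Z}, Continuous q → Continuous z →
        Continuous fun s => Θ (q s) (z s))
    (hΘ : ∀ q, (∃ j, q.coord j = x₀) → ∀ z, Θ q z = 1) {f : PointedMap z₀ x₀}
    (hf : ∀ z, f.1 z = Θ (KPow.mk fun _ => p z) z) : HomotopyClass.mk f = 1 := by
  obtain ⟨G, hG, G_base⟩ := exists_isHomotopyOn_of_homotopicRel hcat
  let Θ' (z : Z) : SmashPower x₀ k → James x₀ := Quotient.lift (Θ · z) (by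
    rintro q q' (rfl | ⟨hq, hq'⟩)
    · rfl
    · rw [hΘ q hq, hΘ q' hq'])
  have continuous_Θ' (K : Type u) [TopologicalSpace K] [CompactSpace K] [T2Space K] (z : K → Z)
      (hz : Continuous z) : Continuous fun a : SmashPower x₀ k × K => Θ' (z a.2) a.1 := by
    refine isQuotientMap_quotient_mk'.continuous_lift_prod_left ?_
    have := compactlyGeneratedSpace_prod_of_locallyCompact (KPow X k) K
    exact continuous_Θ continuous_fst (hz.comp continuous_snd)
  have Θ'_base (z : Z) : Θ' z (SmashPower.base x₀ k) = 1 := hΘ _ ⟨0, rfl⟩ z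
  refine HomotopyClass.mk_eq_mk_of_homotopy (g := 1) (fun z t => Θ' z (G (p z) t)) ?_ (fun z => ?_)
    (fun z => ?_) fun t => ?_
  · refine continuous_from_compactlyGeneratedSpace _ fun K _ _ _ l hl => ?_
    exact (continuous_Θ' K (fun s => (l s).1) (continuous_fst.comp hl)).comp
      ((hG.continuous.comp (f := fun s => (p (l s).1, (l s).2)) (by fun_prop)).prodMk continuous_id)
  · rw [(hG.hasEndpoints _ trivial).left 0 le_rfl, hf]
    rfl
  · rw [(hG.hasEndpoints _ trivial).right 1 le_rfl]
    exact Θ'_base z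
  · rw [hp, G_base]
    exact Θ'_base z₀

namespace PowerClass

variable {X : Type u} [TopologicalSpace X] {x₀ : X} {n : ℕ}

/-- Restriction of classes to the hyperplane where the `i`-th coordinate is the basepoint, composed
with the projection onto this hyperplane. -/
def restrict (x₀ : X) (i : Fin n) : PowerClass x₀ n →* PowerClass x₀ n :=
  HomotopyClass.pullback x₀
    ⟨fun z => z.update i x₀, KPow.continuous_update continuous_id i continuous_const⟩
    (KPow.update_base x₀ i)

theorem restrict_coordinateClass [CompactlyGeneratedSpace X] (i : Fin n) :
    restrict x₀ i (coordinateClass x₀ i) = 1 := by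
  refine congrArg HomotopyClass.mk (a₂ := 1) (Subtype.ext (ContinuousMap.ext fun z => ?_))
  exact (congrArg (James.E x₀) (z.coord_update i x₀)).trans (James.E_base x₀)

end PowerClass

namespace Collar

variable {X : Type u} [TopologicalSpace X] {x₀ : X} (c : Collar x₀) {n : ℕ} (i : Fin n)

/-- The collar deformation of the `i`-th coordinate. -/
def deform (z : KPow X n) (t : ℝ) : KPow X n :=
  z.update i (c.h (z.coord i) t)

theorem deform_zero (z : KPow X n) : c.deform i z 0 = z := by
  rw [deform, c.h_of_nonpos _ 0 le_rfl, KPow.update_coord]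

theorem deform_base (t : ℝ) :
    c.deform i (KPow.mk fun _ => x₀ : KPow X n) t = KPow.mk fun _ => x₀ :=
  (congrArg (KPow.update _ i) (c.h_base t)).trans (KPow.update_base x₀ i)

theorem continuous_deform : Continuous fun p : KPow X n × ℝ => c.deform i p.1 p.2 :=
  KPow.continuous_update continuous_fst i
    (c.continuous_h_comp ((KPow.continuous_coord i).comp continuous_fst) continuous_snd)

/-- The end of the collar deformation of the `i`-th coordinate. -/
def collapse : C(KPow X n, KPow X n) :=
  ⟨fun z => c.deform i z 1, (c.continuous_deform i).comp (Continuous.prodMk_left 1)⟩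

theorem collapse_base :
    c.collapse i (KPow.mk fun _ => x₀ : KPow X n) = KPow.mk fun _ => x₀ :=
  c.deform_base i 1

theorem collapse_of_lt {z : KPow X n} (hz : c.v (z.coord i) < 1) :
    c.collapse i z = z.update i x₀ :=
  congrArg (z.update i) (c.h_of_one_le _ hz 1 le_rfl)

theorem mk_comp_collapse (f : PointedMap (KPow.mk fun _ : Fin n => x₀) x₀) :
    HomotopyClass.mk (f.comp (c.collapse i) (c.collapse_base i)) = HomotopyClass.mk f :=
  (HomotopyClass.mk_eq_mk_of_homotopy (fun z t => f.1 (c.deform i z t))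
    (f.1.continuous.comp (c.continuous_deform i)) (fun z => congrArg f.1 (c.deform_zero i z))
    (fun _ => rfl) fun t => (congrArg f.1 (c.deform_base i t)).trans f.2).symm

end Collar

namespace PowerClass

variable {X : Type u} [TopologicalSpace X] {x₀ : X} {n : ℕ} {i : Fin n}

/-- Collapsing a collar in the `i`-th coordinate makes a representative factor through the
hyperplane over `{v < 1}`, where a null homotopy of its restriction can then be run. -/
theorem exists_mk_eq_of_restrict_eq_one (c : Collar x₀) {a : PowerClass x₀ n}
    (ha : restrict x₀ i a = 1) : ∃ f : PointedMap (KPow.mk fun _ : Fin n => x₀) x₀,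
      HomotopyClass.mk f = a ∧ ∀ z, c.v (z.coord i) ≤ 1 / 2 → f.1 z = 1 := by
  obtain ⟨f, rfl⟩ := HomotopyClass.mk_surjective a
  obtain ⟨N, hN, N_base⟩ := HomotopyClass.exists_homotopy_of_mk_eq_mk (g := 1) ha
  have N_of_nonpos {z : KPow X n} (hz : c.v (z.coord i) < 1) {t : ℝ} (ht : t ≤ 0) :
      N z t = f.1 (c.collapse i z) := by
    rw [(hN.hasEndpoints z trivial).left t ht, c.collapse_of_lt i hz]
    rfl
  let φ (z : KPow X n) : ℝ := 3 - 4 * c.v (z.coord i)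
  have continuous_φ : Continuous φ :=
    continuous_const.sub (continuous_const.mul (c.continuous_v.comp (KPow.continuous_coord i)))
  let H (z : KPow X n) (t : ℝ) : James x₀ := if 0 ≤ φ z then N z (t * φ z) else f.1 (c.collapse i z)
  have continuous_H : Continuous fun p : KPow X n × ℝ => H p.1 p.2 := by
    refine Continuous.if_le ?_ (by fun_prop) continuous_const (by fun_prop) fun p hp => ?_
    · exact hN.continuous.comp (f := fun p : KPow X n × ℝ => (p.1, p.2 * φ p.1)) (by fun_prop)
    · exact N_of_nonpos (by linarith) (by rw [← hp, mul_zero])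
  have H_zero (z : KPow X n) : H z 0 = f.1 (c.collapse i z) :=
    ite_eq_right_iff.2 fun h => N_of_nonpos (by linarith) (zero_mul _).le
  have φ_base : φ (KPow.mk fun _ => x₀) = 3 :=
    sub_eq_self.2 (mul_eq_zero_of_right 4 c.v_base)
  have H_base (t : ℝ) : H (KPow.mk fun _ => x₀) t = 1 :=
    (if_pos (by rw [φ_base]; norm_num)).trans (N_base _)
  refine ⟨⟨⟨fun z => H z 1, continuous_H.comp (Continuous.prodMk_left 1)⟩, H_base 1⟩, ?_,
    fun z hz => ?_⟩
  · rw [← c.mk_comp_collapse i f]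
    exact (HomotopyClass.mk_eq_mk_of_homotopy H continuous_H H_zero (fun _ => rfl) H_base).symm
  · exact (if_pos (by linarith)).trans ((hN.hasEndpoints z trivial).right _ (by linarith))

end PowerClass

/-- The difference of the two products of `f` and `g`, where the `i`-th coordinate is replaced by
the first coordinate of `q` in `f` and by the second one in `g`, with `χ` in place of the inverse
and `D` contracting `w * χ w`. At time `1` it vanishes if one of the coordinates of `q` is the
basepoint. -/
def productDifference {X : Type u} [TopologicalSpace X] {x₀ : X} (c : Collar x₀) {n : ℕ}
    (χ : James x₀ → James x₀) (D : James x₀ → ℝ → James x₀) (i : Fin n)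
    (f g : KPow X n → James x₀) (t : ℝ) (q : KPow X 2) (z : KPow X n) : James x₀ :=
  let a := f (z.update i (q.coord 0))
  let b := g (z.update i (q.coord 1))
  let φ := 3 - 8 * min (c.v (q.coord 0)) (c.v (q.coord 1))
  if 0 ≤ φ then D (a * b) (t * φ) else a * b * χ (b * a)

section ProductDifference

variable {X : Type u} [TopologicalSpace X] {x₀ : X} {c : Collar x₀} {n : ℕ}
  {χ : PointedMap (1 : James x₀) x₀} {D : James x₀ → ℝ → James x₀}
  (hD : IsHomotopyOn Set.univ (PointedMap.id x₀ * χ).1 (1 : PointedMap (1 : James x₀) x₀).1 D)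
  {i : Fin n} {f g : PointedMap (KPow.mk fun _ : Fin n => x₀) x₀}
include hD

theorem productDifference_one {q : KPow X 2} (hq : ∃ j, q.coord j = x₀) (z : KPow X n) :
    productDifference c χ.1 D i f.1 g.1 1 q z = 1 := by
  rw [productDifference, c.min_v_eq_zero_iff.2 hq]
  exact (if_pos (by norm_num)).trans ((hD.hasEndpoints _ trivial).right _ (by norm_num))

variable (hf : ∀ z, c.v (z.coord i) ≤ 1 / 2 → f.1 z = 1)
  (hg : ∀ z, c.v (z.coord i) ≤ 1 / 2 → g.1 z = 1)
include hf hg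

/-- Near the axes one of the two factors is trivial, so that they commute. -/
theorem contraction_mul_eq_mul_of_min_le {q : KPow X 2} (z : KPow X n)
    (hq : min (c.v (q.coord 0)) (c.v (q.coord 1)) ≤ 1 / 2) {t : ℝ} (ht : t ≤ 0) :
    D (f.1 (z.update i (q.coord 0)) * g.1 (z.update i (q.coord 1))) t =
      f.1 (z.update i (q.coord 0)) * g.1 (z.update i (q.coord 1)) *
        χ.1 (g.1 (z.update i (q.coord 1)) * f.1 (z.update i (q.coord 0))) := by
  have h_comm : Commute (f.1 (z.update i (q.coord 0))) (g.1 (z.update i (q.coord 1))) := by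
    rcases min_le_iff.1 hq with h | h
    · rw [hf _ (by rwa [KPow.coord_update])]
      exact Commute.one_left _
    · rw [hg _ (by rwa [KPow.coord_update])]
      exact Commute.one_right _
  rw [(hD.hasEndpoints _ trivial).left t ht, ← h_comm.eq]
  rfl

theorem productDifference_zero (q : KPow X 2) (z : KPow X n) :
    productDifference c χ.1 D i f.1 g.1 0 q z =
      f.1 (z.update i (q.coord 0)) * g.1 (z.update i (q.coord 1)) *
        χ.1 (g.1 (z.update i (q.coord 1)) * f.1 (z.update i (q.coord 0))) :=
  ite_eq_right_iff.2 fun h =>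
    contraction_mul_eq_mul_of_min_le hD hf hg z (by linarith) (zero_mul _).le

theorem continuous_productDifference {T : Type u} [TopologicalSpace T]
    [CompactlyGeneratedSpace T] {t : T → ℝ} {q : T → KPow X 2} {z : T → KPow X n}
    (ht : Continuous t) (hq : Continuous q) (hz : Continuous z) :
    Continuous fun s => productDifference c χ.1 D i f.1 g.1 (t s) (q s) (z s) := by
  have hq_coord (j : Fin 2) : Continuous fun s => (q s).coord j :=
    (KPow.continuous_coord j).comp hq
  have ha := f.1.continuous.comp (KPow.continuous_update hz i (hq_coord 0))
  have hb := g.1.continuous.comp (KPow.continuous_update hz i (hq_coord 1))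
  have hab := James.continuous_mul x₀ ha hb
  refine Continuous.if_le ?_ ?_ continuous_const (by fun_prop) fun s hs => ?_
  · exact hD.continuous.comp₂ hab (by fun_prop)
  · exact James.continuous_mul x₀ hab (χ.1.continuous.comp (James.continuous_mul x₀ hb ha))
  · exact contraction_mul_eq_mul_of_min_le hD hf hg (z s) (by linarith) (by rw [← hs, mul_zero])

end ProductDifference

namespace PowerClass

variable {X : Type u} [TopologicalSpace X] [CompactlyGeneratedSpace X] {x₀ : X} {n : ℕ} {i : Fin n}

theorem mk_mul_mk_mul_mk_comp_eq_one (hcat : WeakLSCategoryLT x₀ 2) (c : Collar x₀)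
    {χ : PointedMap (1 : James x₀) x₀}
    (hχ : HomotopyClass.mk (PointedMap.id x₀) * HomotopyClass.mk χ = 1)
    {f g : PointedMap (KPow.mk fun _ : Fin n => x₀) x₀}
    (hf : ∀ z, c.v (z.coord i) ≤ 1 / 2 → f.1 z = 1)
    (hg : ∀ z, c.v (z.coord i) ≤ 1 / 2 → g.1 z = 1) :
    HomotopyClass.mk f * HomotopyClass.mk g *
      HomotopyClass.mk (χ.comp (g * f).1 (g * f).2) = 1 := by
  obtain ⟨D, hD, D_base⟩ := HomotopyClass.exists_homotopy_of_mk_eq_mk (g := 1) hχ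
  let diag (z : KPow X n) : KPow X 2 := KPow.mk fun _ => z.coord i
  have continuous_diag : Continuous diag :=
    KPow.continuous_mk (continuous_pi fun _ => KPow.continuous_coord i)
  let A (t : ℝ) (z : KPow X n) : James x₀ :=
    productDifference c χ.1 D i f.1 g.1 t (diag z) z
  have continuous_A : Continuous fun p : KPow X n × ℝ => A p.2 p.1 :=
    continuous_productDifference hD hf hg continuous_snd (continuous_diag.comp continuous_fst)
      continuous_fst
  have update_diag (z : KPow X n) (j : Fin 2) : z.update i ((diag z).coord j) = z :=
    z.update_coord i
  have A_zero (z : KPow X n) : A 0 z = f.1 z * g.1 z * χ.1 (g.1 z * f.1 z) := by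
    simpa only [update_diag] using productDifference_zero hD hf hg (diag z) z
  have A_base (t : ℝ) : A t (KPow.mk fun _ => x₀) = 1 := by
    simp only [A, productDifference, update_diag, f.2, g.2, mul_one, D_base, χ.2, ite_self]
  let d : PointedMap (KPow.mk fun _ : Fin n => x₀) x₀ :=
    ⟨⟨A 1, continuous_A.comp (Continuous.prodMk_left 1)⟩, A_base 1⟩
  calc HomotopyClass.mk (f * g * χ.comp (g * f).1 (g * f).2)
      = HomotopyClass.mk d := HomotopyClass.mk_eq_mk_of_homotopy (fun z t => A t z) continuous_A
          A_zero (fun _ => rfl) A_base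
    _ = 1 := hcat.mk_eq_one (p := ⟨fun z => z.coord i, KPow.continuous_coord i⟩) rfl
          (continuous_productDifference hD hf hg continuous_const)
          (fun _ => productDifference_one hD) fun _ => rfl

theorem commute_of_restrict_eq_one (hcat : WeakLSCategoryLT x₀ 2) (c : Collar x₀)
    {a b : PowerClass x₀ n} (ha : restrict x₀ i a = 1) (hb : restrict x₀ i b = 1) :
    Commute a b := by
  obtain ⟨f, rfl, hf⟩ := exists_mk_eq_of_restrict_eq_one c ha
  obtain ⟨g, rfl, hg⟩ := exists_mk_eq_of_restrict_eq_one c hb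
  obtain ⟨b, hb⟩ := HomotopyClass.exists_mk_id_mul_eq_one hcat c
  obtain ⟨χ, rfl⟩ := HomotopyClass.mk_surjective b
  let k := χ.comp (g * f).1 (g * f).2
  have h_inv : HomotopyClass.mk g * HomotopyClass.mk f * HomotopyClass.mk k = 1 :=
    congrArg (HomotopyClass.pullback x₀ (g * f).1 (g * f).2) hb
  exact (HomotopyClass.isUnit hcat c (HomotopyClass.mk k)).mul_right_cancel
    ((mk_mul_mk_mul_mk_comp_eq_one hcat c hb hf hg).trans h_inv.symm)

end PowerClass

/-! ### Cohen's relations in groups generated by elements of abelian normal subgroups -/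

theorem map_cohenCommutator {G H : Type*} [Group G] [Group H] (φ : G →* H) (x y : G) :
    φ (cohenCommutator x y) = cohenCommutator (φ x) (φ y) := by
  simp only [cohenCommutator, map_mul, map_inv]

theorem map_iteratedCommutator {G H : Type*} [Group G] [Group H] (φ : G →* H) (l : List G) :
    φ (iteratedCommutator l) = iteratedCommutator (l.map φ) := by
  cases l with
  | nil => exact map_one φ
  | cons a l => exact (List.foldl_map_hom fun x y => (map_cohenCommutator φ x y).symm).symm

section Algebra

variable {G : Type*} [Group G]

theorem iteratedCommutator_append_singleton {l : List G} (hl : l ≠ []) (a : G) :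
    iteratedCommutator (l ++ [a]) = cohenCommutator (iteratedCommutator l) a := by
  cases l with
  | nil => exact absurd rfl hl
  | cons b l => exact List.foldl_concat cohenCommutator b a l

theorem cohenCommutator_one_left (x : G) : cohenCommutator 1 x = 1 := by
  simp [cohenCommutator]

theorem cohenCommutator_eq_one {x y : G} (h : Commute x y) : cohenCommutator x y = 1 := by
  rw [cohenCommutator, mul_assoc, h.eq]
  group

theorem cohenCommutator_eq_inv_mul_conj (x y : G) :
    cohenCommutator x y = x⁻¹ * (y⁻¹ * x * y⁻¹⁻¹) := by
  simp only [cohenCommutator, inv_inv, mul_assoc]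

theorem cohenCommutator_eq_conj_mul (x y : G) :
    cohenCommutator x y = x⁻¹ * y⁻¹ * x⁻¹⁻¹ * y := by
  rw [cohenCommutator, inv_inv]

section Normal

variable {N : Subgroup G} [hN : N.Normal]

theorem cohenCommutator_mem_of_left {x : G} (hx : x ∈ N) (y : G) : cohenCommutator x y ∈ N := by
  rw [cohenCommutator_eq_inv_mul_conj]
  exact N.mul_mem (N.inv_mem hx) (hN.conj_mem x hx y⁻¹)

theorem cohenCommutator_mem_of_right (x : G) {y : G} (hy : y ∈ N) : cohenCommutator x y ∈ N := by
  rw [cohenCommutator_eq_conj_mul]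
  exact N.mul_mem (hN.conj_mem y⁻¹ (N.inv_mem hy) x⁻¹) hy

variable (hc : ∀ x ∈ N, ∀ y ∈ N, Commute x y)
include hc

theorem cohenCommutator_zpow_left {x : G} (hx : x ∈ N) (y : G) (m : ℤ) :
    cohenCommutator (x ^ m) y = cohenCommutator x y ^ m := by
  have h_comm : Commute x⁻¹ (y⁻¹ * x * y⁻¹⁻¹) := hc _ (N.inv_mem hx) _ (hN.conj_mem x hx y⁻¹)
  rw [cohenCommutator_eq_inv_mul_conj, cohenCommutator_eq_inv_mul_conj, h_comm.mul_zpow, conj_zpow,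
    inv_zpow]

theorem cohenCommutator_zpow_right (x : G) {y : G} (hy : y ∈ N) (m : ℤ) :
    cohenCommutator x (y ^ m) = cohenCommutator x y ^ m := by
  have h_comm : Commute (x⁻¹ * y⁻¹ * x⁻¹⁻¹) y := hc _ (hN.conj_mem _ (N.inv_mem hy) x⁻¹) _ hy
  rw [cohenCommutator_eq_conj_mul, cohenCommutator_eq_conj_mul, h_comm.mul_zpow, conj_zpow,
    inv_zpow]

end Normal

variable {ι : Type*} {a : ι → G} {N : ι → Subgroup G} [∀ i, (N i).Normal]

theorem iteratedCommutator_map_mem (ha : ∀ i, a i ∈ N i) {l : List ι} {i : ι} (hi : i ∈ l) :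
    iteratedCommutator (l.map a) ∈ N i := by
  induction l using List.reverseRecOn with
  | nil => simp at hi
  | append_singleton l j ih =>
    rcases eq_or_ne l [] with rfl | hl
    · obtain rfl : i = j := by simpa using hi
      exact ha i
    · rw [List.map_append, List.map_singleton,
        iteratedCommutator_append_singleton (by simpa using hl)]
      rcases List.mem_append.1 hi with h | h
      · exact cohenCommutator_mem_of_left (ih h) _
      · obtain rfl : i = j := by simpa using h
        exact cohenCommutator_mem_of_right _ (ha i)

variable (hc : ∀ i, ∀ x ∈ N i, ∀ y ∈ N i, Commute x y) (ha : ∀ i, a i ∈ N i)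
include hc ha

theorem iteratedCommutator_map_of_not_nodup {l : List ι} (hl : ¬ l.Nodup) :
    iteratedCommutator (l.map a) = 1 := by
  induction l using List.reverseRecOn with
  | nil => simp at hl
  | append_singleton l j ih =>
    rcases eq_or_ne l [] with rfl | hl'
    · simp at hl
    rw [List.map_append, List.map_singleton,
      iteratedCommutator_append_singleton (by simpa using hl')]
    by_cases h : l.Nodup
    · have hj : j ∈ l := by
        by_contra hj
        exact hl (List.nodup_append_comm.1 (List.nodup_cons.2 ⟨hj, h⟩))
      exact cohenCommutator_eq_one (hc j _ (iteratedCommutator_map_mem ha hj) _ (ha j))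
    · rw [ih h, cohenCommutator_one_left]

theorem iteratedCommutator_map_zpow (l : List (ι × ℤ)) :
    iteratedCommutator (l.map fun p => a p.1 ^ p.2) =
      iteratedCommutator (l.map fun p => a p.1) ^ (l.map Prod.snd).prod := by
  induction l using List.reverseRecOn with
  | nil => simp [iteratedCommutator]
  | append_singleton l p ih =>
    rcases eq_or_ne l [] with rfl | hl
    · simp [iteratedCommutator]
    obtain ⟨q, hq⟩ := List.exists_mem_of_ne_nil l hl
    have hmem : iteratedCommutator (l.map fun p => a p.1) ∈ N q.1 := by
      simpa only [List.map_map, Function.comp_def] using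
        iteratedCommutator_map_mem ha (List.mem_map_of_mem (f := Prod.fst) hq)
    simp only [List.map_append, List.map_singleton, List.prod_append, List.prod_singleton]
    rw [iteratedCommutator_append_singleton (by simpa using hl),
      iteratedCommutator_append_singleton (by simpa using hl), ih,
      cohenCommutator_zpow_right (hc p.1) _ (ha p.1), cohenCommutator_zpow_left (hc q.1) hmem,
      zpow_mul]

end Algebra

theorem lift_eq_one_of_mem_cohenRelators {G : Type*} [Group G] {n : ℕ} {a : Fin n → G}
    {N : Fin n → Subgroup G} [∀ i, (N i).Normal] (hc : ∀ i, ∀ x ∈ N i, ∀ y ∈ N i, Commute x y)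
    (ha : ∀ i, a i ∈ N i) {r : FreeGroup (Fin n)} (hr : r ∈ cohenRelators n) :
    FreeGroup.lift a r = 1 := by
  rcases hr with ⟨l, hl, rfl⟩ | ⟨l, rfl⟩
  · rw [map_iteratedCommutator, List.map_map, ← iteratedCommutator_map_of_not_nodup hc ha hl]
    simp only [Function.comp_def, FreeGroup.lift_apply_of]
  · rw [map_mul, map_inv, map_zpow, map_iteratedCommutator, map_iteratedCommutator, List.map_map,
      List.map_map, mul_inv_eq_one]
    simpa only [Function.comp_def, map_zpow, FreeGroup.lift_apply_of] using
      iteratedCommutator_map_zpow hc ha l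

end

theorem proposition2p2 {X : Type u} [TopologicalSpace X] [CompactlyGeneratedSpace X]
    [PathConnectedSpace X] (x₀ : X) (hx₀ : NondegenerateBasepoint x₀)
    (hcat : WeakLSCategoryLT x₀ 2) (n : ℕ) :
    (∀ c : PowerClass x₀ n, IsUnit c) ∧
      ∃ e : CohenGroup n →* GeometricCohenGroup x₀ n, ∀ i : Fin n,
        ((e (PresentedGroup.of i) : (PowerClass x₀ n)ˣ) : PowerClass x₀ n) =
          coordinateClass x₀ i := by
  obtain ⟨c⟩ := hx₀.nonempty_collar
  have hunit : ∀ a : PowerClass x₀ n, IsUnit a := HomotopyClass.isUnit hcat c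
  choose a ha using fun i : Fin n => hunit (coordinateClass x₀ i)
  let b : Fin n → GeometricCohenGroup x₀ n := fun i => ⟨a i, Subgroup.subset_closure ⟨i, ha i⟩⟩
  let N : Fin n → Subgroup (GeometricCohenGroup x₀ n) := fun i =>
    ((Units.map (PowerClass.restrict x₀ i)).comp (GeometricCohenGroup x₀ n).subtype).ker
  have mem_N i (u : GeometricCohenGroup x₀ n) :
      u ∈ N i ↔ PowerClass.restrict x₀ i ((u : (PowerClass x₀ n)ˣ) : PowerClass x₀ n) = 1 :=
    Units.ext_iff
  have hcomm : ∀ i, ∀ u ∈ N i, ∀ w ∈ N i, Commute u w := fun i u hu w hw =>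
    Subtype.ext <| Units.ext <|
      PowerClass.commute_of_restrict_eq_one hcat c ((mem_N i u).1 hu) ((mem_N i w).1 hw)
  have hb i : b i ∈ N i := (mem_N i _).2 <| by
    rw [ha, PowerClass.restrict_coordinateClass]
  have hN i : (N i).Normal := inferInstance
  refine ⟨hunit, PresentedGroup.toGroup fun r hr => lift_eq_one_of_mem_cohenRelators hcomm hb hr,
    fun i => ?_⟩
  rw [PresentedGroup.toGroup.of]
  exact ha i
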